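/- **Setting.** Let $\mu=(v,w,\sigma)\in\Omega=\mathbb V\times\mathbb W\times\mathbb S$ with $\mathbb V\subset\mathbb R^{n_v}$, $\mathbb W\subset\mathbb R^{n_w}$, $\mathbb S\subset\mathbb R^{n_\sigma}$ compact. Consider the plant $$\dot z=f(z,y,\mu),\qquad \dot y=g(z,y,\mu)+b(z,y,\mu)u,\qquad e=y-h(v,w),$$ with $z\in\mathbb R^{n_z}$ and $y,u,e\in\mathbb R$, and the exosystem $\dot v=S(\sigma)v$ ($w,\sigma$ constant), where $f,g,b,h,S$ are continuously differentiable, $v(t)\in\mathbb V$ for all $t\ge0$ whenever $v(0)\in\mathbb V$, $\sigma\in\mathbb S$, and $0<b^*\le b(z,y,\mu)\le\bar b^*$ for all $(z,y)$ and all $\mu\in\Omega$. Assume: 1. There is a continuously differentiable $\mathbf z^\star=\mathbf z^\star(v,\sigma,w)$ with $\frac{\partial \mathbf z^\star}{\partial v}S(\sigma)v=f(\mathbf z^\star,h(v,w),\mu)$ on $\Omega$. Put $\mathbf u=b(\mathbf z^\star,h,\mu)^{-1}\big(\frac{\partial h}{\partial v}S(\sigma)v-g(\mathbf z^\star,h,\mu)\big)$.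 2. For every $\sigma\in\mathbb S$ the eigenvalues of $S(\sigma)$ are distinct with zero real part. 3. $\mathbf u$ is a polynomial in $v$ with coefficients depending on $(w,\sigma)$. 4. Along the exosystem $\mathbf u(v(t),\sigma,w)=\sum_{j=1}^{n}C_j(v(0),w,\sigma)e^{\imath\omega_j(\sigma)t}$ with $n\ge1$, distinct real $\omega_j(\sigma)$, and $C_j(v(0),w,\sigma)\ne0$ for all $j$ and all $(v(0),w,\sigma)\in\Omega$. Let $a(\sigma)\in\mathbb R^n$ be the coefficient vector with $\mathbf u^{(n)}+a_1\mathbf u+a_2\mathbf u'+\dots+a_n\mathbf u^{(n-1)}=0$ along the exosystem. Let $\Phi(a)$ be the $n\times n$ companion matrix (ones above the diagonal, last row $-a_1,\dots,-a_n$), $M$ the $2n\times 2n$ companion matrix with last row $-m_1,\dots,-m_{2n}$, assumed Hurwitz, $N=\mathrm{col}(0,\dots,0,1)\in\mathbb R^{2n}$, $\Gamma=(1,0,\dots,0)\in\mathbb R^{1\times n}$, $\Xi(a)=\Phi(a)^{2n}+\sum_{j=1}^{2n}m_j\Phi(a)^{j-1}$, $\Theta(\theta)=[\theta_{i+j-1}]_{i,j=1}^n$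 for $\theta\in\mathbb R^{2n}$, and $$\boldsymbol\eta^\star(v(t),\sigma,w)=\int_{-\infty}^te^{M(t-\tau)}N\mathbf u(v(\tau),\sigma,w)\,d\tau .$$ Let $\chi(\eta,\hat a)=\Gamma\,\Xi(\hat a)\,\mathrm{col}(\eta_1,\dots,\eta_n)$. Let $\mathbb D\subset\mathbb R^{2n}\times\mathbb R^n$ be a compact set containing $(\boldsymbol\eta^\star(\mu),a(\sigma))$ for every $\mu\in\Omega$, $\delta=\max_{\mathbb D}\|\mathrm{col}(\eta,\hat a)\|^2$, and $\chi_s(\eta,\hat a)=\chi(\eta,\hat a)\,\Psi(\delta+1-\|\mathrm{col}(\eta,\hat a)\|^2)$, where $\Psi(\varsigma)=\frac{\psi(\varsigma)}{\psi(\varsigma)+\psi(1-\varsigma)}$, $\psi(\varsigma)=e^{-1/\varsigma}$ for $\varsigma>0$ and $\psi(\varsigma)=0$ for $\varsigma\le0$. Let $k_1>0$, and consider the internal model and the learning law $$\dot\eta=M\eta+Nu,\qquad \dot{\hat a}=-k_1\Theta(\eta)^\top\big[\Theta(\eta)\hat a+\mathrm{col}(\eta_{n+1},\dots,\eta_{2n})\big].$$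 Put $\bar z=z-\mathbf z^\star$, $\bar b(\bar z,e,\mu)=b(\bar z+\mathbf z^\star,e+h(v,w),\mu)$, $\bar\eta=\eta-\boldsymbol\eta^\star-\bar b^{-1}Ne$, $\bar Z=\mathrm{col}(\bar\eta,\bar z)$, $\bar\eta_e=\bar\eta+\bar b^{-1}Ne$, $\bar a=\hat a-a(\sigma)$, $\bar\chi_s=\chi_s(\boldsymbol\eta^\star+\bar\eta_e,\bar a+a)-\chi(\boldsymbol\eta^\star,a)$. The parameter error equation of the augmented error system is $$\dot{\bar a}=-k_1\Theta(\boldsymbol\eta^\star)^\top\Theta(\boldsymbol\eta^\star)\bar a-k_1\bar O(\bar\eta_e,\bar a),$$ where, with $t(\theta)=\mathrm{col}(\theta_{n+1},\dots,\theta_{2n})$, $\Theta_\star=\Theta(\boldsymbol\eta^\star)$, $\Theta_e=\Theta(\bar\eta_e)$, $$\bar O=\Theta_\star^\top\Theta_e\bar a+\Theta_e^\top\Theta_\star\bar a+\Theta_e^\top\Theta_ea+\Theta_e^\top\Theta_e\bar a+\Theta_\star^\top\Theta_ea+\Theta_\star^\top t(\bar\eta_e)+\Theta_e^\top t(\bar\eta_e).$$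 **Statement.** The function $V_{\bar a}(\bar a)=\ln(1+\|\bar a\|^2)$ is smooth, and there are $\underline\alpha_{\bar a},\overline\alpha_{\bar a}\in\mathcal K_\infty$, a bounded class $\mathcal K$ function $\alpha_{\bar a}$ (i.e. $\alpha_{\bar a}\in\mathcal K_o$) and positive constants $c,\phi_0,\phi_1,\phi_2$, all independent of $\mu\in\Omega$ and of the state, such that: * (iISS Lyapunov function) $\underline\alpha_{\bar a}(\|\bar a\|^2)\le V_{\bar a}(\bar a)\le\overline\alpha_{\bar a}(\|\bar a\|^2)$ for all $\bar a\in\mathbb R^n$, and $$\dot V_{\bar a}\le-\alpha_{\bar a}(V_{\bar a})+c\,\|\bar Z\|^2+c\,e^2,$$ where $\dot V_{\bar a}$ is the derivative of $V_{\bar a}$ along the parameter error equation, at every $(\bar z,\bar\eta,e,\bar a)$ and every $\mu\in\Omega$; the same inequality holds for $\frac{d}{dt}V_{\bar a}(\hat a(t)-a(\sigma))$ along every solution, on an interval $[0,T)$ and with an arbitrary control input $u(t)$, of the plant with the internal model and the learning law, with $\mu(0)\in\Omega$. * (mismatch) For all $(\bar z,\bar\eta,e,\bar a)$ and all $\mu\in\Omega$,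 $$|\bar b(\bar z,e,\mu)|^2\,|\bar\chi_s(\bar\eta_e,\bar a,\mu)|^2\le\phi_0e^2+\phi_1\|\bar Z\|^2+\phi_2\,\alpha_{\bar a}(V_{\bar a}(\bar a)).$$ -/

import Mathlib

open scoped Matrix ContDiff

noncomputable section

namespace OutputReg

/-- `ℝ^k` with the Euclidean norm. -/
abbrev Vec (k : ℕ) := EuclideanSpace ℝ (Fin k)

/-- A matrix acting on Euclidean vectors. -/
def act {k l : ℕ} (A : Matrix (Fin k) (Fin l) ℝ) (x : Vec l) : Vec k :=
  WithLp.toLp 2 (A *ᵥ x.ofLp)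

/-! ### Comparison functions (only the values on `[0, ∞)` matter) -/

/-- Class `𝒦`: continuous, positive definite and strictly increasing on `[0, ∞)`. -/
structure IsClassK (α : ℝ → ℝ) : Prop where
  cont : ContinuousOn α (Set.Ici 0)
  zero : α 0 = 0
  mono : StrictMonoOn α (Set.Ici 0)

/-- Class `𝒦_∞`: the unbounded class `𝒦` functions. -/
def IsClassKInf (α : ℝ → ℝ) : Prop := IsClassK α ∧ ¬ BddAbove (α '' Set.Ici 0)

/-- Class `𝒦_o`: the bounded class `𝒦` functions. -/
def IsClassKo (α : ℝ → ℝ) : Prop := IsClassK α ∧ BddAbove (α '' Set.Ici 0)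

/-! ### The plant, the exosystem and the regulator equations -/

/-- The uncertainty `μ = (v, w, σ)`: exosystem state, plant uncertainty, exosystem parameter. -/
abbrev Par (nv nw ns : ℕ) := Vec nv × Vec nw × Vec ns

/-- The plant `ż = f(z,y,μ)`, `ẏ = g(z,y,μ) + b(z,y,μ) u`, `e = y - h(v,w)`, the linear exosystem
`v̇ = S(σ) v`, and the sets `𝕍`, `𝕎`, `𝕊` in which `v`, `w`, `σ` range. -/
structure Plant (nz nv nw ns : ℕ) where
  f : Vec nz → ℝ → Par nv nw ns → Vec nz
  g : Vec nz → ℝ → Par nv nw ns → ℝ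
  b : Vec nz → ℝ → Par nv nw ns → ℝ
  h : Vec nv → Vec nw → ℝ
  S : Vec ns → Matrix (Fin nv) (Fin nv) ℝ
  setV : Set (Vec nv)
  setW : Set (Vec nw)
  setS : Set (Vec ns)

namespace Plant

variable {nz nv nw ns : ℕ} (P : Plant nz nv nw ns)

/-- `𝕍 × 𝕎 × 𝕊`. -/
def Ω : Set (Par nv nw ns) := P.setV ×ˢ P.setW ×ˢ P.setS

/-- The value at time `t` of the uncertainty whose value at time `0` is `μ = (v, w, σ)`: the
exosystem state moves to `exp(t S(σ)) v`, while `w` and `σ` are constant. -/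
def flow (t : ℝ) (μ : Par nv nw ns) : Par nv nw ns :=
  (act (NormedSpace.exp (t • P.S μ.2.2)) μ.1, μ.2.1, μ.2.2)

/-- Standing assumptions: the data are globally defined and continuously differentiable, the three
sets are compact, `𝕍` is invariant under the exosystem, and `b` lies between two positive
constants on `𝕍 × 𝕎 × 𝕊`. -/
structure Standing : Prop where
  smooth_f : ContDiff ℝ 1 fun p : Vec nz × ℝ × Par nv nw ns => P.f p.1 p.2.1 p.2.2
  smooth_g : ContDiff ℝ 1 fun p : Vec nz × ℝ × Par nv nw ns => P.g p.1 p.2.1 p.2.2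
  smooth_b : ContDiff ℝ 1 fun p : Vec nz × ℝ × Par nv nw ns => P.b p.1 p.2.1 p.2.2
  smooth_h : ContDiff ℝ 1 fun p : Vec nv × Vec nw => P.h p.1 p.2
  smooth_S : ∀ i j, ContDiff ℝ 1 fun σ => P.S σ i j
  compact_V : IsCompact P.setV
  compact_W : IsCompact P.setW
  compact_S : IsCompact P.setS
  invariant : ∀ μ ∈ P.Ω, ∀ t : ℝ, 0 ≤ t → (P.flow t μ).1 ∈ P.setV
  b_lower : ∃ bl : ℝ, 0 < bl ∧ ∀ μ ∈ P.Ω, ∀ z y, bl ≤ P.b z y μ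
  b_upper : ∃ bu : ℝ, 0 < bu ∧ ∀ μ ∈ P.Ω, ∀ z y, P.b z y μ ≤ bu

/-- `h(v,w)` as a function of `μ`. -/
def hμ (μ : Par nv nw ns) : ℝ := P.h μ.1 μ.2.1

/-- `zs = 𝐳⋆` is a continuously differentiable solution on `𝕍 × 𝕎 × 𝕊` of the regulator equation
`(∂𝐳⋆/∂v) S(σ) v = f(𝐳⋆, h(v,w), μ)`. -/
structure Regulator (zs : Par nv nw ns → Vec nz) : Prop where
  smooth : ∀ μ ∈ P.Ω, ContDiffAt ℝ 1 zs μ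
  eq : ∀ μ ∈ P.Ω,
    fderiv ℝ (fun v => zs (v, μ.2)) μ.1 (act (P.S μ.2.2) μ.1) = P.f (zs μ) (P.hμ μ) μ

/-- The steady-state input
`𝐮(v,σ,w) = b(𝐳⋆,h,μ)⁻¹ ((∂h/∂v) S(σ) v - g(𝐳⋆,h,μ))`. -/
def uss (zs : Par nv nw ns → Vec nz) (μ : Par nv nw ns) : ℝ :=
  (P.b (zs μ) (P.hμ μ) μ)⁻¹ *
    (fderiv ℝ (fun v => P.h v μ.2.1) μ.1 (act (P.S μ.2.2) μ.1) - P.g (zs μ) (P.hμ μ) μ)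

/-- For every `σ ∈ 𝕊` the eigenvalues of `S(σ)` are distinct and have zero real part. -/
def ImaginarySpectrum : Prop :=
  ∀ σ ∈ P.setS, ((P.S σ).map Complex.ofReal).charpoly.roots.Nodup ∧
    ∀ l ∈ ((P.S σ).map Complex.ofReal).charpoly.roots, l.re = 0

/-- `𝐮` is a polynomial in `v`, with coefficients that depend on `(w, σ)`. -/
def PolynomialInput (zs : Par nv nw ns → Vec nz) : Prop :=
  ∃ p : Vec nw → Vec ns → MvPolynomial (Fin nv) ℝ,
    ∀ μ ∈ P.Ω, P.uss zs μ = MvPolynomial.eval μ.1.ofLp (p μ.2.1 μ.2.2)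

/-- Along the exosystem, `𝐮` is the sum of exactly `n` exponentials:
`𝐮(v(t),σ,w) = ∑ⱼ Cⱼ(v(0),w,σ) exp(i freqⱼ(σ) t)` with distinct real frequencies `freqⱼ(σ)`. -/
def ModalExpansion (zs : Par nv nw ns → Vec nz) {n : ℕ} (freq : Vec ns → Fin n → ℝ)
    (C : Par nv nw ns → Fin n → ℂ) : Prop :=
  (∀ σ ∈ P.setS, Function.Injective (freq σ)) ∧
    ∀ μ ∈ P.Ω, ∀ t : ℝ, (P.uss zs (P.flow t μ) : ℂ) =
      ∑ j, C μ j * Complex.exp (Complex.I * (freq μ.2.2 j : ℂ) * (t : ℂ))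

/-- Along the exosystem, `𝐮` solves the linear differential equation
`𝐮⁽ⁿ⁾ + a₁(σ) 𝐮 + a₂(σ) 𝐮' + ⋯ + aₙ(σ) 𝐮⁽ⁿ⁻¹⁾ = 0`. -/
def GeneratorCoeff (zs : Par nv nw ns → Vec nz) {n : ℕ} (a : Vec ns → Vec n) : Prop :=
  ∀ μ ∈ P.Ω, ∀ t : ℝ, iteratedDeriv n (fun τ => P.uss zs (P.flow τ μ)) t +
    ∑ i : Fin n, a μ.2.2 i * iteratedDeriv (i : ℕ) (fun τ => P.uss zs (P.flow τ μ)) t = 0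

end Plant

/-! ### The internal model and the nonparametric learning law -/

/-- The companion matrix with ones above the diagonal and last row `-c₁, …, -c_k`. -/
def companion {k : ℕ} (c : Fin k → ℝ) : Matrix (Fin k) (Fin k) ℝ := fun i j =>
  if (i : ℕ) + 1 = k then -c j else if (j : ℕ) = (i : ℕ) + 1 then 1 else 0

/-- `N = col(0, …, 0, 1) ∈ ℝ^{2n}`. -/
def Nvec (n : ℕ) : Vec (2 * n) :=
  WithLp.toLp 2 fun i => if (i : ℕ) + 1 = 2 * n then 1 else 0

/-- All eigenvalues have negative real part. -/
def IsHurwitz {k : ℕ} (A : Matrix (Fin k) (Fin k) ℝ) : Prop :=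
  ∀ l ∈ (A.map Complex.ofReal).charpoly.roots, l.re < 0

/-- The Hankel matrix `Θ(θ)`, with entries `θ_{i+j-1}`, `1 ≤ i, j ≤ n`. -/
def Hankel {n : ℕ} (θ : Vec (2 * n)) : Matrix (Fin n) (Fin n) ℝ := fun i j =>
  θ ⟨(i : ℕ) + (j : ℕ), by omega⟩

/-- `col(θ₁, …, θₙ)`. -/
def headVec {n : ℕ} (θ : Vec (2 * n)) : Vec n := WithLp.toLp 2 fun i => θ ⟨(i : ℕ), by omega⟩

/-- `col(θ_{n+1}, …, θ_{2n})`. -/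
def tailVec {n : ℕ} (θ : Vec (2 * n)) : Vec n :=
  WithLp.toLp 2 fun i => θ ⟨n + (i : ℕ), by omega⟩

/-- `Ξ(a) = Φ(a)^{2n} + ∑_{j=1}^{2n} m_j Φ(a)^{j-1}`, where `Φ(a)` is the companion matrix of `a`. -/
def Xi {n : ℕ} (m : Fin (2 * n) → ℝ) (a : Vec n) : Matrix (Fin n) (Fin n) ℝ :=
  companion a.ofLp ^ (2 * n) + ∑ j : Fin (2 * n), m j • companion a.ofLp ^ (j : ℕ)

/-- The row `Γ = (1, 0, …, 0)`. -/
def Gam (n : ℕ) : Fin n → ℝ := fun j => if (j : ℕ) = 0 then 1 else 0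

/-- `χ(η, â) = Γ Ξ(â) col(η₁, …, ηₙ)`. -/
def chi {n : ℕ} (m : Fin (2 * n) → ℝ) (η : Vec (2 * n)) (ah : Vec n) : ℝ :=
  Gam n ⬝ᵥ (Xi m ah *ᵥ (headVec η).ofLp)

/-- `δ = max_{(η, â) ∈ 𝔻} ‖col(η, â)‖²`. -/
def deltaD {n : ℕ} (D : Set (Vec (2 * n) × Vec n)) : ℝ :=
  sSup ((fun p => ‖p.1‖ ^ 2 + ‖p.2‖ ^ 2) '' D)

/-- `χ_s(η, â) = χ(η, â) Ψ(δ + 1 - ‖col(η, â)‖²)`. Here `Ψ(ς) = ψ(ς) / (ψ(ς) + ψ(1 - ς))` with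
`ψ(ς) = exp(-1/ς)` for `ς > 0` and `ψ(ς) = 0` otherwise, which is `Real.smoothTransition`. -/
def chiS {n : ℕ} (m : Fin (2 * n) → ℝ) (D : Set (Vec (2 * n) × Vec n))
    (η : Vec (2 * n)) (ah : Vec n) : ℝ :=
  chi m η ah * Real.smoothTransition (deltaD D + 1 - (‖η‖ ^ 2 + ‖ah‖ ^ 2))

/-- The learning law: `d â / dt = -k₁ Θ(η)ᵀ (Θ(η) â + col(η_{n+1}, …, η_{2n}))`. -/
def learnField {n : ℕ} (k1 : ℝ) (η : Vec (2 * n)) (ah : Vec n) : Vec n :=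
  -(k1 • act (Hankel η)ᵀ (act (Hankel η) ah + tailVec η))

/-- The term `Ō(η̄ₑ, ā)`, for the steady state `ηs = 𝛈⋆` and the true parameter `a`. -/
def Obar {n : ℕ} (ηs : Vec (2 * n)) (a : Vec n) (ηe : Vec (2 * n)) (ab : Vec n) : Vec n :=
  act (Hankel ηs)ᵀ (act (Hankel ηe) ab) + act (Hankel ηe)ᵀ (act (Hankel ηs) ab)
    + act (Hankel ηe)ᵀ (act (Hankel ηe) a) + act (Hankel ηe)ᵀ (act (Hankel ηe) ab)
    + act (Hankel ηs)ᵀ (act (Hankel ηe) a) + act (Hankel ηs)ᵀ (tailVec ηe)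
    + act (Hankel ηe)ᵀ (tailVec ηe)

/-- The right-hand side of the parameter error equation
`d ā / dt = -k₁ Θ(𝛈⋆)ᵀ Θ(𝛈⋆) ā - k₁ Ō(η̄ₑ, ā)`. -/
def abarField {n : ℕ} (k1 : ℝ) (ηs : Vec (2 * n)) (a : Vec n) (ηe : Vec (2 * n))
    (ab : Vec n) : Vec n :=
  -(k1 • act (Hankel ηs)ᵀ (act (Hankel ηs) ab)) - k1 • Obar ηs a ηe ab

/-- `V_ā(ā) = ln(1 + ‖ā‖²)`. -/
def Vabar {n : ℕ} (ab : Vec n) : ℝ := Real.log (1 + ‖ab‖ ^ 2)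

namespace Plant

variable {nz nv nw ns : ℕ} (P : Plant nz nv nw ns)

/-- `𝛈⋆(v(t),σ,w) = ∫_{-∞}^t exp(M (t-τ)) N 𝐮(v(τ),σ,w) dτ` at `t = 0`, `(v(0),w,σ) = μ`, where `M`
is the companion matrix of `m`. -/
def etaStar (zs : Par nv nw ns → Vec nz) {n : ℕ} (m : Fin (2 * n) → ℝ) (μ : Par nv nw ns) :
    Vec (2 * n) :=
  ∫ τ in Set.Iic (0 : ℝ),
    P.uss zs (P.flow τ μ) • act (NormedSpace.exp ((-τ) • companion m)) (Nvec n)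

/-- `b̄(z̄, e, μ) = b(z̄ + 𝐳⋆, e + h(v,w), μ)`. -/
def bBar (zs : Par nv nw ns → Vec nz) (zb : Vec nz) (e : ℝ) (μ : Par nv nw ns) : ℝ :=
  P.b (zb + zs μ) (e + P.hμ μ) μ

/-- `η̄ₑ = η̄ + b̄(z̄, e, μ)⁻¹ N e`. -/
def etaE (zs : Par nv nw ns → Vec nz) {n : ℕ} (zb : Vec nz) (ηb : Vec (2 * n)) (e : ℝ)
    (μ : Par nv nw ns) : Vec (2 * n) :=
  ηb + ((P.bBar zs zb e μ)⁻¹ * e) • Nvec n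

/-- The mismatch `χ̄_s(η̄ₑ, ā, μ) = χ_s(𝛈⋆ + η̄ₑ, ā + a) - χ(𝛈⋆, a)`. -/
def chiBarS (zs : Par nv nw ns → Vec nz) {n : ℕ} (m : Fin (2 * n) → ℝ) (a : Vec ns → Vec n)
    (D : Set (Vec (2 * n) × Vec n)) (ηe : Vec (2 * n)) (ab : Vec n) (μ : Par nv nw ns) : ℝ :=
  chiS m D (P.etaStar zs m μ + ηe) (ab + a μ.2.2) - chi m (P.etaStar zs m μ) (a μ.2.2)

/-- `(z, y, η, â)` solves, on `[0, T)` and with control input `u`, the plant together with the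
internal model `η̇ = M η + N u` and the learning law; the uncertainty at time `t` is
`P.flow t μ₀`. -/
structure ClosedLoop {n : ℕ} (m : Fin (2 * n) → ℝ) (k1 T : ℝ) (μ₀ : Par nv nw ns)
    (u : ℝ → ℝ) (z : ℝ → Vec nz) (y : ℝ → ℝ) (η : ℝ → Vec (2 * n)) (ah : ℝ → Vec n) : Prop where
  z_eq : ∀ t ∈ Set.Ico 0 T,
    HasDerivWithinAt z (P.f (z t) (y t) (P.flow t μ₀)) (Set.Ico 0 T) t
  y_eq : ∀ t ∈ Set.Ico 0 T,
    HasDerivWithinAt y (P.g (z t) (y t) (P.flow t μ₀) + P.b (z t) (y t) (P.flow t μ₀) * u t)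
      (Set.Ico 0 T) t
  η_eq : ∀ t ∈ Set.Ico 0 T,
    HasDerivWithinAt η (act (companion m) (η t) + u t • Nvec n) (Set.Ico 0 T) t
  ah_eq : ∀ t ∈ Set.Ico 0 T,
    HasDerivWithinAt ah (learnField k1 (η t) (ah t)) (Set.Ico 0 T) t

/-- The error coordinate `e = y - h(v,w)`. -/
def errE (y : ℝ) (μ : Par nv nw ns) : ℝ := y - P.hμ μ

/-- The error coordinate `η̄ = η - 𝛈⋆ - b̄(z̄, e, μ)⁻¹ N e`, with `z̄ = z - 𝐳⋆`. -/
def errEta (zs : Par nv nw ns → Vec nz) {n : ℕ} (m : Fin (2 * n) → ℝ) (z : Vec nz) (y : ℝ)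
    (η : Vec (2 * n)) (μ : Par nv nw ns) : Vec (2 * n) :=
  η - P.etaStar zs m μ - ((P.bBar zs (z - zs μ) (P.errE y μ) μ)⁻¹ * P.errE y μ) • Nvec n

end Plant

end OutputReg

end

open OutputReg

/-! Along the exosystem the steady-state input is a sum of `n` exponentials with nonzero amplitudes.
The stable filter with companion matrix `M` multiplies each mode by a nonzero gain, and its shift
rows make the `i`-th component (counted from zero) of `etaStar` equal to `∑ j, d j * (I ω_j) ^ i`
with every `d j ≠ 0` (`etaStar_modes`). Two facts follow. The Hankel matrix of `etaStar` is `Vᵀ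
diag(d) V` with `V` a Vandermonde matrix, so it is nonsingular, and uniformly so because `etaStar`
is continuous on the compact `Ω` (`exists_hankel_lower_bound`). Each `I ω_j` is a root of the
polynomial with coefficients `a`, so the true parameter solves the regression exactly
(`hankel_etaStar_eq`), and the learning law is the parameter error equation
(`abarField_eq_learnField`).

The integral for `etaStar` runs over negative times, while `𝕍` is only forward invariant. The
imaginary simple spectrum closes this gap: the exosystem group is bounded, hence recurrent, and
backward orbits stay in the closed set `𝕍` (`exp_mem_of_forward`).

For the dissipation, the residual is `p + q` with `p = Θ(η) ā` and `q` linear in `η̄ₑ`. Replacing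
`Θ(η)` by `Θ(𝛈⋆)` in `p` costs a term of order `‖η̄ₑ‖² ‖ā‖²`; the factor `1 / (1 + ‖ā‖²)` in the
gradient of the logarithm makes it at most a multiple of `‖η̄ₑ‖²`. What remains is the decay `κ ‖ā‖²
/ (1 + ‖ā‖²) = κ (1 - exp(-V))`, a bounded class `𝒦` function of `V` (`fderiv_Vabar_learnField_le`).
The saturated map `chiS` is smooth with compact support, hence bounded and Lipschitz, so its squared
increment is controlled by `‖η̄ₑ‖²` and `min(‖ā‖², 1)`, the latter comparable to the same decay rate
(`exists_chiS_sub_sq_le`). -/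

noncomputable section

namespace OutputReg

/-! ### Matrix exponentials -/

section MatrixExp

open Polynomial

variable {k : ℕ}

attribute [local instance] Matrix.linftyOpNormedRing Matrix.linftyOpNormedAlgebra
  Matrix.linftyOpNormedAddCommGroup Matrix.linftyOpNormedSpace

theorem hasDerivAt_exp_mulVec (A : Matrix (Fin k) (Fin k) ℂ) (x : Fin k → ℂ) (t : ℝ) :
    HasDerivAt (fun s : ℝ => NormedSpace.exp (s • A) *ᵥ x)
      (A *ᵥ (NormedSpace.exp (t • A) *ᵥ x)) t := by
  have h := hasDerivAt_exp_smul_const' (𝕂 := ℝ) A t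
  have h2 := ((Matrix.mulVecBilin ℝ ℝ (m := Fin k) (n := Fin k) (A := ℂ)).flip x
    ).toContinuousLinearMap.hasFDerivAt.comp_hasDerivAt t h
  rw [Matrix.mulVec_mulVec]
  exact h2

theorem commute_exp_smul (A : Matrix (Fin k) (Fin k) ℂ) (t : ℝ) :
    Commute A (NormedSpace.exp (t • A)) :=
  ((Commute.refl A).smul_right t).exp_right

theorem hasDerivAt_exp_mulVec' (A : Matrix (Fin k) (Fin k) ℂ) (x : Fin k → ℂ) (t : ℝ) :
    HasDerivAt (fun s : ℝ => NormedSpace.exp (s • A) *ᵥ x)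
      (NormedSpace.exp (t • A) *ᵥ (A *ᵥ x)) t := by
  have h := hasDerivAt_exp_mulVec A x t
  rwa [Matrix.mulVec_mulVec, (commute_exp_smul A t).eq, ← Matrix.mulVec_mulVec] at h

theorem continuous_exp_real {k : ℕ} :
    Continuous (NormedSpace.exp : Matrix (Fin k) (Fin k) ℝ → Matrix (Fin k) (Fin k) ℝ) :=
  NormedSpace.exp_continuous

theorem exp_map_ofReal (A : Matrix (Fin k) (Fin k) ℝ) :
    (NormedSpace.exp A).map Complex.ofReal = NormedSpace.exp (A.map Complex.ofReal) := by
  have hc : Continuous (Complex.ofRealHom.mapMatrix (m := Fin k)) := by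
    exact continuous_id.matrix_map Complex.continuous_ofReal
  exact NormedSpace.map_exp Complex.ofRealHom.mapMatrix hc A

theorem ofReal_exp_mulVec (A : Matrix (Fin k) (Fin k) ℝ) (x : Fin k → ℝ) (t : ℝ) (i : Fin k) :
    (((NormedSpace.exp (t • A) *ᵥ x) i : ℝ) : ℂ) =
      (NormedSpace.exp (t • A.map Complex.ofReal) *ᵥ fun j => (x j : ℂ)) i := by
  have : t • A.map Complex.ofReal = (t • A).map Complex.ofReal := by
    ext i j; simp
  rw [this, ← exp_map_ofReal]
  simp [Matrix.mulVec, dotProduct]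

theorem exp_add_smul_mulVec (A : Matrix (Fin k) (Fin k) ℝ) (x : Fin k → ℝ) (s t : ℝ) :
    NormedSpace.exp ((s + t) • A) *ᵥ x =
      NormedSpace.exp (s • A) *ᵥ (NormedSpace.exp (t • A) *ᵥ x) := by
  rw [add_smul, Matrix.exp_add_of_commute _ _ (((Commute.refl A).smul_right t).smul_left s),
    Matrix.mulVec_mulVec]

/-- Peel off one root `l`: the vector `(A - l) x` is killed by the remaining factors, and `exp(-l t)
exp(tA) x` has derivative `exp(-l t) exp(tA) (A - l) x`, which can be integrated. The strict gap
between `l.re` and `-ε` absorbs the polynomial factors that repeated roots would produce. -/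
theorem exp_decay_of_aeval_prod (A : Matrix (Fin k) (Fin k) ℂ) {ε : ℝ} (s : Multiset ℂ)
    (hs : ∀ l ∈ s, l.re < -ε) :
    ∀ x : Fin k → ℂ, aeval A (s.map fun l => X - C l).prod *ᵥ x = 0 →
      ∃ K, 0 ≤ K ∧ ∀ t : ℝ, 0 ≤ t →
        ‖NormedSpace.exp (t • A) *ᵥ x‖ ≤ K * Real.exp (-ε * t) := by
  induction s using Multiset.induction with
  | empty =>
    intro x hx
    refine ⟨0, le_rfl, fun t _ => ?_⟩
    have : x = 0 := by simpa using hx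
    simp [this]
  | cons l s ih =>
    intro x hx
    have hl : l.re < -ε := hs l (Multiset.mem_cons_self l s)
    obtain ⟨K, hK0, hK⟩ := ih (fun l' hl' => hs l' (Multiset.mem_cons_of_mem hl'))
      (A *ᵥ x - l • x) (by
        rw [Multiset.map_cons, Multiset.prod_cons, mul_comm, map_mul, ← Matrix.mulVec_mulVec]
          at hx
        rw [← hx]
        congr 1
        simp [Matrix.sub_mulVec, Algebra.algebraMap_eq_smul_one, Matrix.smul_mulVec])
    set r : ℝ := -l.re - ε with hr
    have hr0 : 0 < r := by linarith
    set F : ℝ → Fin k → ℂ := fun t =>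
      Complex.exp (-l * t) • (NormedSpace.exp (t • A) *ᵥ x) with hF
    have hnorm : ∀ t : ℝ, ‖Complex.exp (-l * t)‖ = Real.exp (-l.re * t) := by
      intro t; rw [Complex.norm_exp]; simp
    have hd : ∀ t : ℝ, HasDerivAt F (Complex.exp (-l * t) •
        (NormedSpace.exp (t • A) *ᵥ (A *ᵥ x - l • x))) t := by
      intro t
      have h1 : HasDerivAt (fun t : ℝ => Complex.exp (-l * t)) (Complex.exp (-l * t) * (-l)) t := by
        have := ((Complex.ofRealCLM.hasDerivAt (x := t)).const_mul (-l)).cexp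
        simpa using this
      have h2 := h1.smul (hasDerivAt_exp_mulVec' A x t)
      refine h2.congr_deriv ?_
      rw [Matrix.mulVec_sub, Matrix.mulVec_smul, smul_sub, mul_smul, neg_smul, smul_neg]
      abel
    refine ⟨‖x‖ + K / r, by positivity, fun t ht => ?_⟩
    -- Integrates `‖F'‖ ≤ K exp(r t)`; the positive constant of integration dropped from the bound
    -- is harmless.
    have key : ‖F t‖ ≤ ‖x‖ + K / r * Real.exp (r * t) := by
      refine image_norm_le_of_norm_deriv_right_le_deriv_boundary (a := 0) (b := t)
        (B := fun t => ‖x‖ + K / r * Real.exp (r * t)) (B' := fun t => K * Real.exp (r * t))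
        (fun u _ => (hd u).continuousAt.continuousWithinAt)
        (fun u _ => (hd u).hasDerivWithinAt) ?_ ?_ ?_ ⟨ht, le_rfl⟩
      · simp [hF]; positivity
      · intro u
        have := (((hasDerivAt_id u).const_mul r).exp.const_mul (K / r)).const_add ‖x‖
        refine this.congr_deriv ?_
        simp only [id]; field_simp
      · intro u hu
        rw [norm_smul, hnorm]
        refine (mul_le_mul_of_nonneg_left (hK u hu.1) (Real.exp_pos _).le).trans (le_of_eq ?_)
        rw [mul_left_comm, ← Real.exp_add]
        congr 2; rw [hr]; ring
    have h1 : (1 : ℝ) ≤ Real.exp (r * t) := Real.one_le_exp (by positivity)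
    have h3 : ‖F t‖ ≤ (‖x‖ + K / r) * Real.exp (r * t) := by
      refine key.trans ?_
      rw [add_mul]
      gcongr
      exact le_mul_of_one_le_right (norm_nonneg _) h1
    have h4 : NormedSpace.exp (t • A) *ᵥ x = Complex.exp (l * t) • F t := by
      rw [hF, smul_smul, ← Complex.exp_add]; simp
    have h5 : ‖Complex.exp (l * t)‖ = Real.exp (l.re * t) := by
      rw [Complex.norm_exp]; simp
    rw [h4, norm_smul, h5]
    calc Real.exp (l.re * t) * ‖F t‖
        ≤ Real.exp (l.re * t) * ((‖x‖ + K / r) * Real.exp (r * t)) := by gcongr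
      _ = (‖x‖ + K / r) * Real.exp (-ε * t) := by
        rw [mul_left_comm, ← Real.exp_add]; congr 2; rw [hr]; ring

theorem aeval_prod_charpoly_roots (A : Matrix (Fin k) (Fin k) ℂ) :
    aeval A (A.charpoly.roots.map fun l => X - C l).prod = 0 := by
  rw [← (IsAlgClosed.splits A.charpoly).eq_prod_roots_of_monic A.charpoly_monic,
    Matrix.aeval_self_charpoly]

theorem exists_re_lt_neg (s : Multiset ℂ) (hs : ∀ l ∈ s, l.re < 0) :
    ∃ ε : ℝ, 0 < ε ∧ ∀ l ∈ s, l.re < -ε := by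
  induction s using Multiset.induction with
  | empty => exact ⟨1, one_pos, by simp⟩
  | cons l s ih =>
    obtain ⟨ε, hε, h⟩ := ih fun l' hl' => hs l' (Multiset.mem_cons_of_mem hl')
    have hl := hs l (Multiset.mem_cons_self l s)
    refine ⟨min ε (-l.re / 2), lt_min hε (by linarith), fun l' hl' => ?_⟩
    rcases Multiset.mem_cons.1 hl' with rfl | h'
    · have := min_le_right ε (-l'.re / 2); linarith
    · have := h l' h'; have := min_le_left ε (-l.re / 2); linarith

/-- The exponential of a Hurwitz matrix decays exponentially. -/
theorem IsHurwitz.exp_decay {A : Matrix (Fin k) (Fin k) ℝ} (hA : IsHurwitz A) (x : Fin k → ℂ) :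
    ∃ ε K : ℝ, 0 < ε ∧ 0 ≤ K ∧ ∀ t : ℝ, 0 ≤ t →
      ‖NormedSpace.exp (t • A.map Complex.ofReal) *ᵥ x‖ ≤ K * Real.exp (-ε * t) := by
  obtain ⟨ε, hε, h⟩ := exists_re_lt_neg _ hA
  obtain ⟨K, hK0, hK⟩ := exp_decay_of_aeval_prod (A.map Complex.ofReal) _ h x
    (by rw [aeval_prod_charpoly_roots, Matrix.zero_mulVec])
  exact ⟨ε, K, hε, hK0, hK⟩

theorem exp_bounded_of_eigenvector (A : Matrix (Fin k) (Fin k) ℂ) {l : ℂ} (hl : l.re = 0)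
    {x : Fin k → ℂ} (hx : A *ᵥ x = l • x) (t : ℝ) :
    ‖NormedSpace.exp (t • A) *ᵥ x‖ ≤ ‖x‖ := by
  have hd : ∀ t : ℝ, HasDerivAt (fun t : ℝ =>
      Complex.exp (-l * t) • (NormedSpace.exp (t • A) *ᵥ x)) 0 t := by
    intro t
    have h1 : HasDerivAt (fun t : ℝ => Complex.exp (-l * t)) (Complex.exp (-l * t) * (-l)) t := by
      have := ((Complex.ofRealCLM.hasDerivAt (x := t)).const_mul (-l)).cexp
      simpa using this
    refine (h1.smul (hasDerivAt_exp_mulVec' A x t)).congr_deriv ?_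
    rw [hx, Matrix.mulVec_smul, mul_smul, neg_smul, smul_neg]
    abel
  have hc := is_const_of_deriv_eq_zero (fun t => (hd t).differentiableAt)
    (fun t => (hd t).deriv) t 0
  have hn := congrArg norm hc
  rw [norm_smul, Complex.norm_exp] at hn
  simp [hl] at hn
  exact hn.le

/-- Partial fractions: if `(A - l) x = ∑ w_p` with eigenvectors `w_p`, then subtracting `∑ (p - l)⁻¹
w_p` from `x` leaves a vector killed by `A - l`. -/
theorem exists_eigenvector_sum (A : Matrix (Fin k) (Fin k) ℂ) (s : Finset ℂ) :
    ∀ x : Fin k → ℂ, aeval A (∏ l ∈ s, (X - C l)) *ᵥ x = 0 →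
      ∃ w : ℂ → Fin k → ℂ, (∀ l ∈ s, A *ᵥ w l = l • w l) ∧ x = ∑ l ∈ s, w l := by
  induction s using Finset.induction_on with
  | empty =>
    intro x hx
    exact ⟨0, by simp, by simpa using hx⟩
  | insert l s hls ih =>
    intro x hx
    obtain ⟨w, hw, hsum⟩ := ih (A *ᵥ x - l • x) (by
      rw [Finset.prod_insert hls, mul_comm, map_mul, ← Matrix.mulVec_mulVec] at hx
      rw [← hx]
      congr 1
      simp [Matrix.sub_mulVec, Algebra.algebraMap_eq_smul_one, Matrix.smul_mulVec])
    have hne : ∀ l' ∈ s, l' - l ≠ 0 := fun l' hl' h => hls (sub_eq_zero.1 h ▸ hl')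
    have hneq : ∀ l' ∈ s, l' ≠ l := fun l' hl' h => hls (h ▸ hl')
    refine ⟨fun l' => if l' = l then x - ∑ p ∈ s, (p - l)⁻¹ • w p else (l' - l)⁻¹ • w l',
      fun l' hl' => ?_, ?_⟩
    · rcases Finset.mem_insert.1 hl' with rfl | h'
      · simp only [if_true]
        have hAx : A *ᵥ x = l' • x + ∑ p ∈ s, w p := by rw [← hsum]; abel
        have hA : A *ᵥ ∑ p ∈ s, (p - l')⁻¹ • w p = ∑ p ∈ s, ((p - l')⁻¹ * p) • w p := by
          rw [Matrix.mulVec_sum]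
          refine Finset.sum_congr rfl fun p hp => ?_
          rw [Matrix.mulVec_smul, hw p hp, smul_smul]
        rw [Matrix.mulVec_sub, hAx, hA, smul_sub, Finset.smul_sum, add_sub_assoc,
          ← Finset.sum_sub_distrib, sub_eq_add_neg, ← Finset.sum_neg_distrib]
        congr 1
        refine Finset.sum_congr rfl fun p hp => ?_
        have := hne p hp
        rw [smul_smul, ← neg_smul]
        nth_rewrite 1 [← one_smul ℂ (w p)]
        rw [← sub_smul]
        congr 1
        field_simp
        ring
      · simp only [if_neg (hneq l' h')]
        rw [Matrix.mulVec_smul, hw l' h', smul_comm]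
    · rw [Finset.sum_insert hls]
      simp only [if_true]
      rw [Finset.sum_congr rfl fun p hp => if_neg (hneq p hp)]
      abel

/-- The exponential group of a matrix with distinct, purely imaginary eigenvalues is bounded. -/
theorem exp_bounded_of_imaginary (A : Matrix (Fin k) (Fin k) ℝ)
    (hnd : (A.map Complex.ofReal).charpoly.roots.Nodup)
    (hre : ∀ l ∈ (A.map Complex.ofReal).charpoly.roots, l.re = 0) :
    ∃ K : ℝ, ∀ (t : ℝ) (x : Fin k → ℝ), ‖NormedSpace.exp (t • A) *ᵥ x‖ ≤ K * ‖x‖ := by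
  set B := A.map Complex.ofReal
  have hx : ∀ x : Fin k → ℂ, ∃ K, ∀ t : ℝ, ‖NormedSpace.exp (t • B) *ᵥ x‖ ≤ K := by
    intro x
    obtain ⟨w, hw, hsum⟩ := exists_eigenvector_sum B ⟨B.charpoly.roots, hnd⟩ x (by
      have := aeval_prod_charpoly_roots B
      rw [Finset.prod_mk, this, Matrix.zero_mulVec])
    refine ⟨∑ l ∈ (⟨B.charpoly.roots, hnd⟩ : Finset ℂ), ‖w l‖, fun t => ?_⟩
    rw [hsum, Matrix.mulVec_sum]
    exact (norm_sum_le _ _).trans (Finset.sum_le_sum fun l hl =>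
      exp_bounded_of_eigenvector B (hre l hl) (hw l hl) t)
  choose K hK using fun i : Fin k => hx fun j => ((Pi.single i (1 : ℝ) : Fin k → ℝ) j : ℂ)
  have hr : ∀ (i : Fin k) (t : ℝ), ‖NormedSpace.exp (t • A) *ᵥ (Pi.single i (1 : ℝ))‖ ≤ K i := by
    intro i t
    refine (pi_norm_le_iff_of_nonneg ((norm_nonneg _).trans (hK i t))).2 fun j => ?_
    have h := (norm_le_pi_norm _ j).trans (hK i t)
    rwa [← ofReal_exp_mulVec, Complex.norm_real] at h
  refine ⟨∑ i, K i, fun t x => ?_⟩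
  have hdec : x = ∑ i, x i • (Pi.single i (1 : ℝ) : Fin k → ℝ) := by
    simpa using pi_eq_sum_univ' x
  nth_rewrite 1 [hdec]
  rw [Matrix.mulVec_sum, Finset.sum_mul]
  refine (norm_sum_le _ _).trans (Finset.sum_le_sum fun i _ => ?_)
  rw [Matrix.mulVec_smul, norm_smul, mul_comm]
  exact mul_le_mul (hr i t) (norm_le_pi_norm x i) (norm_nonneg _)
    ((norm_nonneg _).trans (hr i t))

/-- For a bounded exponential group, a closed set that contains a forward orbit contains the whole
orbit. -/
theorem exp_mem_of_forward (A : Matrix (Fin k) (Fin k) ℝ) {K : ℝ}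
    (hK : ∀ (t : ℝ) (x : Fin k → ℝ), ‖NormedSpace.exp (t • A) *ᵥ x‖ ≤ K * ‖x‖)
    {V : Set (Fin k → ℝ)} (hV : IsClosed V) {x : Fin k → ℝ}
    (hx : ∀ t : ℝ, 0 ≤ t → NormedSpace.exp (t • A) *ᵥ x ∈ V) (τ : ℝ) :
    NormedSpace.exp (τ • A) *ᵥ x ∈ V := by
  -- Poincaré recurrence: the integer orbit of `y` converges along `φ`, so the times `φ (2j) - φ j`
  -- bring `y` back to itself in the limit. They are at least `j`, hence eventually exceed `-τ`, and
  -- the returning points lie on the forward orbit of `x`.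
  obtain ⟨y, hy⟩ : ∃ y, y = NormedSpace.exp (τ • A) *ᵥ x := ⟨_, rfl⟩
  rw [← hy]
  obtain ⟨L, -, φ, hφ, hL⟩ := tendsto_subseq_of_bounded
    (Metric.isBounded_closedBall (x := (0 : Fin k → ℝ)) (r := K * ‖y‖))
    (x := fun j : ℕ => NormedSpace.exp ((j : ℝ) • A) *ᵥ y)
    (fun j => by simpa using hK j y)
  have hdiff : Filter.Tendsto (fun j : ℕ => NormedSpace.exp ((φ (2 * j) : ℝ) • A) *ᵥ y -
      NormedSpace.exp ((φ j : ℝ) • A) *ᵥ y) Filter.atTop (nhds 0) := by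
    have h2 : Filter.Tendsto (fun j : ℕ => 2 * j) Filter.atTop Filter.atTop :=
      Filter.tendsto_atTop_mono (fun j => show j ≤ 2 * j by omega) Filter.tendsto_id
    simpa using (hL.comp h2).sub hL
  have hret : Filter.Tendsto (fun j : ℕ =>
      NormedSpace.exp (((φ (2 * j) : ℝ) - φ j) • A) *ᵥ y) Filter.atTop (nhds y) := by
    rw [tendsto_iff_norm_sub_tendsto_zero]
    refine squeeze_zero (fun _ => norm_nonneg _) (fun j => ?_)
      (by simpa using hdiff.norm.const_mul K)
    -- Pulling back by `exp(-φ j A)` is where the bound for negative times is needed.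
    have : NormedSpace.exp (((φ (2 * j) : ℝ) - φ j) • A) *ᵥ y - y =
        NormedSpace.exp ((-(φ j) : ℝ) • A) *ᵥ (NormedSpace.exp ((φ (2 * j) : ℝ) • A) *ᵥ y -
          NormedSpace.exp ((φ j : ℝ) • A) *ᵥ y) := by
      rw [Matrix.mulVec_sub, ← exp_add_smul_mulVec, ← exp_add_smul_mulVec]
      have h0 : (-(φ j : ℝ) + φ j) = 0 := by ring
      rw [h0, zero_smul, NormedSpace.exp_zero, Matrix.one_mulVec, sub_eq_neg_add ((φ (2 * j) : ℝ))]
    rw [this]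
    exact hK _ _
  refine hV.mem_of_tendsto hret ?_
  filter_upwards [Filter.eventually_ge_atTop ⌈-τ⌉₊] with j hj
  rw [hy, ← exp_add_smul_mulVec]
  refine hx _ ?_
  have h1 : j + φ j ≤ φ (2 * j) := by
    have := hφ.add_le_nat j j
    rw [two_mul]; omega
  have h2 : (j : ℝ) + φ j ≤ φ (2 * j) := by exact_mod_cast h1
  have h3 : -τ ≤ j := (Nat.le_ceil _).trans (by exact_mod_cast hj)
  linarith

end MatrixExp
/-! ### The exosystem flow and the steady-state input -/

namespace Plant

variable {nz nv nw ns : ℕ} {P : Plant nz nv nw ns}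

theorem Standing.isCompact_Ω (hP : P.Standing) : IsCompact P.Ω :=
  hP.compact_V.prod (hP.compact_W.prod hP.compact_S)

theorem Standing.flow_mem (hP : P.Standing) (hS : P.ImaginarySpectrum) {μ : Par nv nw ns}
    (hμ : μ ∈ P.Ω) (t : ℝ) : P.flow t μ ∈ P.Ω := by
  refine ⟨?_, hμ.2⟩
  obtain ⟨hnd, hre⟩ := hS μ.2.2 hμ.2.2
  obtain ⟨K, hK⟩ := exp_bounded_of_imaginary (P.S μ.2.2) hnd hre
  have hcl : IsClosed ((WithLp.toLp 2 : (Fin nv → ℝ) → Vec nv) ⁻¹' P.setV) :=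
    hP.compact_V.isClosed.preimage (PiLp.continuous_toLp 2 _)
  exact exp_mem_of_forward (P.S μ.2.2) hK hcl
    (x := μ.1.ofLp) (fun s hs => hP.invariant μ hμ s hs) t

theorem Standing.continuous_S (hP : P.Standing) : Continuous P.S :=
  continuous_matrix fun i j => (hP.smooth_S i j).continuous

theorem Standing.continuous_flow (hP : P.Standing) (t : ℝ) : Continuous (P.flow t) := by
  have h1 : Continuous fun μ : Par nv nw ns => NormedSpace.exp (t • P.S μ.2.2) :=
    continuous_exp_real.comp
      ((hP.continuous_S.comp (continuous_snd.comp continuous_snd)).const_smul t)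
  have h2 : Continuous fun μ : Par nv nw ns => μ.1.ofLp :=
    (PiLp.continuous_ofLp 2 _).comp continuous_fst
  exact ((PiLp.continuous_toLp 2 _).comp (h1.matrix_mulVec h2)).prodMk continuous_snd

theorem Standing.continuousOn_uss (hP : P.Standing) {zs : Par nv nw ns → Vec nz}
    (hzs : P.Regulator zs) : ContinuousOn (P.uss zs) P.Ω := by
  obtain ⟨bl, hbl, hb⟩ := hP.b_lower
  have hz : ContinuousOn zs P.Ω :=
    fun μ hμ => (hzs.smooth μ hμ).continuousAt.continuousWithinAt
  have hh : Continuous fun μ : Par nv nw ns => P.hμ μ :=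
    hP.smooth_h.continuous.comp (continuous_fst.prodMk (continuous_fst.comp continuous_snd))
  have harg : ContinuousOn (fun μ : Par nv nw ns => (zs μ, P.hμ μ, μ)) P.Ω :=
    hz.prodMk (hh.continuousOn.prodMk continuousOn_id)
  have hd : Continuous fun μ : Par nv nw ns =>
      fderiv ℝ (fun v => P.h v μ.2.1) μ.1 (act (P.S μ.2.2) μ.1) := by
    have h1 : Continuous fun μ : Par nv nw ns => fderiv ℝ (fun v => P.h v μ.2.1) μ.1 := by
      have hu : ContDiff ℝ 1
          (Function.uncurry fun (p : Vec nv × Vec nw) (v : Vec nv) => P.h v p.2) :=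
        hP.smooth_h.comp (contDiff_snd.prodMk (contDiff_snd.comp contDiff_fst))
      have h0 := ContDiff.fderiv (m := 1) (n := 0) hu (g := Prod.fst) contDiff_fst (by simp)
      exact h0.continuous.comp (continuous_fst.prodMk (continuous_fst.comp continuous_snd))
    have h2 : Continuous fun μ : Par nv nw ns => act (P.S μ.2.2) μ.1 :=
      (PiLp.continuous_toLp 2 _).comp
        ((hP.continuous_S.comp (continuous_snd.comp continuous_snd)).matrix_mulVec
          ((PiLp.continuous_ofLp 2 _).comp continuous_fst))
    exact h1.clm_apply h2
  refine ContinuousOn.mul (ContinuousOn.inv₀ (hP.smooth_b.continuous.comp_continuousOn harg) ?_)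
    (hd.continuousOn.sub (hP.smooth_g.continuous.comp_continuousOn harg))
  exact fun μ hμ => (hbl.trans_le (hb μ hμ _ _)).ne'

end Plant

/-! ### The steady state of the internal model -/

section SteadyState

open MeasureTheory

/-- The complexified impulse response `exp(t M) N` of the internal model. -/
def impulse {n : ℕ} (m : Fin (2 * n) → ℝ) (t : ℝ) : Fin (2 * n) → ℂ :=
  NormedSpace.exp (t • (companion m).map Complex.ofReal) *ᵥ fun j => (Nvec n j : ℂ)

/-- The steady-state response of the internal model to `exp(i w t)`, at `t = 0`. -/
def modalGain {n : ℕ} (m : Fin (2 * n) → ℝ) (w : ℝ) (i : Fin (2 * n)) : ℂ :=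
  ∫ τ in Set.Iic (0 : ℝ), Complex.exp (Complex.I * w * τ) * impulse m (-τ) i

variable {n : ℕ} {m : Fin (2 * n) → ℝ}

theorem ofReal_act_exp (t : ℝ) (i : Fin (2 * n)) :
    ((act (NormedSpace.exp (t • companion m)) (Nvec n) i : ℝ) : ℂ) = impulse m t i :=
  ofReal_exp_mulVec (companion m) (Nvec n).ofLp t i

theorem hasDerivAt_impulse (t : ℝ) (i : Fin (2 * n)) :
    HasDerivAt (fun t => impulse m t i)
      (((companion m).map Complex.ofReal *ᵥ impulse m t) i) t :=
  hasDerivAt_pi.1 (hasDerivAt_exp_mulVec _ _ t) i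

theorem continuous_impulse (i : Fin (2 * n)) : Continuous fun t => impulse m t i :=
  continuous_iff_continuousAt.2 fun t => (hasDerivAt_impulse t i).continuousAt

theorem impulse_zero : impulse m 0 = fun j => (Nvec n j : ℂ) := by
  simp [impulse]

theorem exists_impulse_bound (hM : IsHurwitz (companion m)) :
    ∃ ε K : ℝ, 0 < ε ∧ 0 ≤ K ∧ ∀ τ : ℝ, τ ≤ 0 → ∀ i,
      ‖impulse m (-τ) i‖ ≤ K * Real.exp (ε * τ) := by
  obtain ⟨ε, K, hε, hK0, hK⟩ := hM.exp_decay fun j => (Nvec n j : ℂ)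
  refine ⟨ε, K, hε, hK0, fun τ hτ i => ?_⟩
  have h := (norm_le_pi_norm _ i).trans (hK (-τ) (neg_nonneg.2 hτ))
  rwa [neg_mul_neg] at h

theorem norm_exp_I_mul (w τ : ℝ) : ‖Complex.exp (Complex.I * w * τ)‖ = 1 := by
  rw [mul_assoc, mul_comm, ← Complex.ofReal_mul, Complex.norm_exp_ofReal_mul_I]

theorem integrableOn_modal (hM : IsHurwitz (companion m)) (w : ℝ) (i : Fin (2 * n)) :
    IntegrableOn (fun τ : ℝ => Complex.exp (Complex.I * w * τ) * impulse m (-τ) i)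
      (Set.Iic 0) := by
  obtain ⟨ε, K, hε, hK0, hK⟩ := exists_impulse_bound hM
  refine Integrable.mono' ((integrableOn_exp_mul_Iic hε 0).const_mul K) ?_ ?_
  · refine Continuous.aestronglyMeasurable ?_
    exact (by fun_prop : Continuous fun τ : ℝ => Complex.exp (Complex.I * w * τ)).mul
      ((continuous_impulse i).comp continuous_neg)
  · filter_upwards [ae_restrict_mem measurableSet_Iic] with τ hτ
    rw [norm_mul, norm_exp_I_mul, one_mul]
    exact hK τ hτ i

/-- The modal gain solves `(i w - M) L = N`. -/
theorem modalGain_eq (hM : IsHurwitz (companion m)) (w : ℝ) (i : Fin (2 * n)) :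
    Complex.I * w * modalGain m w i -
      ((companion m).map Complex.ofReal *ᵥ modalGain m w) i = (Nvec n i : ℂ) := by
  obtain ⟨ε, K, hε, hK0, hK⟩ := exists_impulse_bound hM
  -- The identity is the fundamental theorem of calculus for `F` on `(-∞, 0]`: `F 0` is the
  -- component of `N`, and `F` vanishes at `-∞` because `M` is Hurwitz.
  set F : ℝ → ℂ := fun τ => Complex.exp (Complex.I * w * τ) * impulse m (-τ) i with hF
  set F' : ℝ → ℂ := fun τ => Complex.I * w * (Complex.exp (Complex.I * w * τ) * impulse m (-τ) i)
    - ∑ j, (companion m i j : ℂ) * (Complex.exp (Complex.I * w * τ) * impulse m (-τ) j) with hF'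
  have hd : ∀ τ : ℝ, HasDerivAt F (F' τ) τ := by
    intro τ
    have h1 : HasDerivAt (fun τ : ℝ => Complex.exp (Complex.I * w * τ))
        (Complex.exp (Complex.I * w * τ) * (Complex.I * w)) τ := by
      simpa using ((Complex.ofRealCLM.hasDerivAt (x := τ)).const_mul (Complex.I * w)).cexp
    have h2 := (hasDerivAt_impulse (m := m) (-τ) i).scomp τ (hasDerivAt_neg τ)
    refine (h1.mul h2).congr_deriv ?_
    simp only [hF', Matrix.mulVec, dotProduct, Matrix.map_apply, neg_smul, one_smul, mul_neg,
      Finset.mul_sum, Function.comp]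
    rw [← sub_eq_add_neg]
    congr 1
    · ring
    · exact Finset.sum_congr rfl fun j _ => by ring
  have hint1 := integrableOn_modal hM w
  have hint : IntegrableOn F' (Set.Iic 0) :=
    ((hint1 i).const_mul _).sub (integrable_finsetSum _ fun j _ => (hint1 j).const_mul _)
  have hlim : Filter.Tendsto F Filter.atBot (nhds 0) := by
    have hexp : Filter.Tendsto (fun τ : ℝ => K * Real.exp (ε * τ)) Filter.atBot (nhds 0) := by
      simpa using (Real.tendsto_exp_atBot.comp
        (Filter.tendsto_id.const_mul_atBot hε)).const_mul K
    refine squeeze_zero_norm' ?_ hexp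
    filter_upwards [Filter.eventually_le_atBot (0 : ℝ)] with τ hτ
    rw [hF, norm_mul, norm_exp_I_mul, one_mul]
    exact hK τ hτ i
  have h := integral_Iic_of_hasDerivAt_of_tendsto' (fun τ _ => hd τ) hint hlim
  have hF0 : F 0 = (Nvec n i : ℂ) := by simp [hF, impulse_zero]
  rw [hF0, sub_zero] at h
  rw [← h, hF', integral_sub ((hint1 i).const_mul _)
    (integrable_finsetSum _ fun j _ => (hint1 j).const_mul _), integral_const_mul,
    integral_finsetSum _ fun j _ => (hint1 j).const_mul _]
  simp only [integral_const_mul]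
  rfl

theorem companion_mulVec_of_lt {k : ℕ} (c : Fin k → ℝ) (x : Fin k → ℂ) (i : ℕ) (hi : i + 1 < k) :
    ((companion c).map Complex.ofReal *ᵥ x) ⟨i, by omega⟩ = x ⟨i + 1, hi⟩ := by
  simp only [Matrix.mulVec, dotProduct, Matrix.map_apply, companion]
  rw [Finset.sum_eq_single ⟨i + 1, hi⟩]
  · simp [hi.ne]
  · intro j _ hj
    have : (j : ℕ) ≠ i + 1 := fun h => hj (Fin.ext h)
    simp [hi.ne, this]
  · simp

/-- Every row of `(i w - M) L = N` except the last reads `i w L_i = L_{i+1}`, since there `M` is a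
shift and `N` is zero. -/
theorem modalGain_pow (hM : IsHurwitz (companion m)) (hn : 0 < n) (w : ℝ) :
    ∀ (i : ℕ) (hi : i < 2 * n),
      modalGain m w ⟨i, hi⟩ = (Complex.I * w) ^ i * modalGain m w ⟨0, by omega⟩ := by
  intro i
  induction i with
  | zero => intro hi; simp
  | succ i ih =>
    intro hi
    have h := modalGain_eq hM w ⟨i, by omega⟩
    rw [companion_mulVec_of_lt m _ i hi, ih (by omega)] at h
    have hN : Nvec n ⟨i, by omega⟩ = 0 := by simp [Nvec, hi.ne]
    rw [hN, Complex.ofReal_zero, sub_eq_zero] at h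
    rw [← h, pow_succ]
    ring

/-- If the first component vanished, so would all of `L`, contradicting the last row, where `N`
equals `1`. -/
theorem modalGain_ne_zero (hM : IsHurwitz (companion m)) (hn : 0 < n) (w : ℝ) :
    modalGain m w ⟨0, by omega⟩ ≠ 0 := by
  intro h0
  have hz : modalGain m w = 0 := by
    ext ⟨i, hi⟩
    rw [modalGain_pow hM hn w i hi, h0, mul_zero]; rfl
  have h := modalGain_eq hM w ⟨2 * n - 1, by omega⟩
  have hN : Nvec n ⟨2 * n - 1, by omega⟩ = 1 := by
    have : 2 * n - 1 + 1 = 2 * n := by omega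
    simp [Nvec, this]
  rw [hz, hN] at h
  simp at h

end SteadyState
-- Linear independence of exponentials and characteristic roots.
section ExponentialSums

variable {n : ℕ} {u : ℝ → ℝ} {c : Fin n → ℂ} {w : Fin n → ℝ}

theorem hasDerivAt_sum_exp (c : Fin n → ℂ) (w : Fin n → ℝ) (t : ℝ) :
    HasDerivAt (fun t : ℝ => ∑ j, c j * Complex.exp (Complex.I * (w j : ℂ) * (t : ℂ)))
      (∑ j, c j * (Complex.I * w j) * Complex.exp (Complex.I * (w j : ℂ) * (t : ℂ))) t := by
  refine HasDerivAt.fun_sum fun j _ => ?_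
  have h := ((Complex.ofRealCLM.hasDerivAt (x := t)).const_mul (Complex.I * (w j : ℂ))).cexp
  refine (h.const_mul (c j)).congr_deriv ?_
  simp only [Complex.ofRealCLM_apply, Complex.ofReal_one]
  ring

theorem ofReal_iteratedDeriv_of_sum_exp
    (hu : ∀ t : ℝ, (u t : ℂ) = ∑ j, c j * Complex.exp (Complex.I * (w j : ℂ) * (t : ℂ))) (k : ℕ) :
    ∀ t : ℝ, ((iteratedDeriv k u t : ℝ) : ℂ) =
      ∑ j, c j * (Complex.I * w j) ^ k * Complex.exp (Complex.I * (w j : ℂ) * (t : ℂ)) := by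
  induction k with
  | zero => simpa using hu
  | succ k ih =>
    intro t
    have hG := hasDerivAt_sum_exp (fun j => c j * (Complex.I * w j) ^ k) w t
    -- Differentiability of the real function comes from writing it as a real part; only then can
    -- the two complex derivatives be compared.
    have hre : iteratedDeriv k u = fun t : ℝ =>
        (∑ j, c j * (Complex.I * w j) ^ k * Complex.exp (Complex.I * (w j : ℂ) * (t : ℂ))).re := by
      ext t; rw [← ih t, Complex.ofReal_re]
    have hdiff : DifferentiableAt ℝ (iteratedDeriv k u) t := by
      rw [hre]
      exact (Complex.reCLM.hasFDerivAt.comp_hasDerivAt t hG).differentiableAt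
    have hd := hdiff.hasDerivAt.ofReal_comp
    have hfun : (fun y : ℝ => ((iteratedDeriv k u y : ℝ) : ℂ)) = fun t : ℝ =>
        ∑ j, c j * (Complex.I * w j) ^ k * Complex.exp (Complex.I * (w j : ℂ) * (t : ℂ)) :=
      funext ih
    rw [hfun] at hd
    rw [iteratedDeriv_succ, hd.unique hG]
    exact Finset.sum_congr rfl fun j _ => by rw [pow_succ]; ring

theorem injective_I_mul (hw : Function.Injective w) :
    Function.Injective fun j => Complex.I * (w j : ℂ) := fun i j h => by
  refine hw (Complex.ofReal_injective ?_)
  exact mul_left_cancel₀ Complex.I_ne_zero h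

/-- All derivatives at `0` vanish, giving a homogeneous Vandermonde system with distinct nodes. -/
theorem coeff_eq_zero_of_sum_exp_eq_zero (hw : Function.Injective w)
    (h : ∀ t : ℝ, ∑ j, c j * Complex.exp (Complex.I * (w j : ℂ) * (t : ℂ)) = 0) : c = 0 := by
  refine Matrix.eq_zero_of_forall_pow_sum_mul_pow_eq_zero (injective_I_mul hw) fun k => ?_
  have := ofReal_iteratedDeriv_of_sum_exp (u := 0) (c := c) (w := w) (fun t => by simp [h t]) k 0
  simpa using this.symm

/-- The frequencies of a sum of exponentials are roots of the characteristic polynomial of any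
linear differential equation that it solves. -/
theorem char_root_of_sum_exp (hw : Function.Injective w) (hc : ∀ j, c j ≠ 0)
    (hu : ∀ t : ℝ, (u t : ℂ) = ∑ j, c j * Complex.exp (Complex.I * (w j : ℂ) * (t : ℂ)))
    {a : Fin n → ℝ}
    (ha : ∀ t : ℝ, iteratedDeriv n u t + ∑ i : Fin n, a i * iteratedDeriv (i : ℕ) u t = 0)
    (j : Fin n) :
    (Complex.I * w j) ^ n + ∑ i : Fin n, (a i : ℂ) * (Complex.I * w j) ^ (i : ℕ) = 0 := by
  -- The differential operator multiplies mode `j` by its characteristic value, so the new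
  -- amplitudes must all be zero.
  have h0 : (fun j => c j * ((Complex.I * w j) ^ n +
      ∑ i : Fin n, (a i : ℂ) * (Complex.I * w j) ^ (i : ℕ))) = 0 := by
    refine coeff_eq_zero_of_sum_exp_eq_zero hw fun t => ?_
    have h := congrArg (Complex.ofReal) (ha t)
    push_cast at h
    simp only [ofReal_iteratedDeriv_of_sum_exp hu, Finset.mul_sum] at h
    rw [Finset.sum_comm, ← Finset.sum_add_distrib] at h
    rw [← h]
    refine Finset.sum_congr rfl fun j _ => ?_
    rw [mul_add, add_mul, Finset.mul_sum, Finset.sum_mul]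
    congr 1
    exact Finset.sum_congr rfl fun i _ => by ring
  exact (mul_eq_zero.1 (congrFun h0 j)).resolve_left (hc j)

end ExponentialSums

/-! ### Hankel matrices of modal sequences. -/

section HankelOfModes

variable {n : ℕ} {θ : Vec (2 * n)} {d x : Fin n → ℂ}

/-- A Hankel matrix built from `n` distinct modes with nonzero weights is nonsingular. -/
theorem hankel_det_ne_zero (hx : Function.Injective x) (hd : ∀ j, d j ≠ 0)
    (hθ : ∀ i, (θ i : ℂ) = ∑ j, d j * x j ^ (i : ℕ)) : (Hankel θ).det ≠ 0 := by
  have hfac : (Hankel θ).map Complex.ofReal =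
      (Matrix.vandermonde x)ᵀ * Matrix.diagonal d * Matrix.vandermonde x := by
    ext k l
    rw [Matrix.mul_assoc, Matrix.mul_apply]
    simp only [Matrix.map_apply, Hankel, hθ, Matrix.diagonal_mul, Matrix.transpose_apply,
      Matrix.vandermonde_apply]
    exact Finset.sum_congr rfl fun j _ => by rw [pow_add]; ring
  intro h0
  have h1 : ((Hankel θ).map Complex.ofReal).det = 0 := by
    have := (Complex.ofRealHom.map_det (Hankel θ)).symm
    rw [h0, map_zero] at this
    exact this
  rw [hfac, Matrix.det_mul, Matrix.det_mul, Matrix.det_transpose, Matrix.det_diagonal] at h1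
  have hv : (Matrix.vandermonde x).det ≠ 0 := Matrix.det_vandermonde_ne_zero_iff.2 hx
  exact mul_ne_zero (mul_ne_zero hv (Finset.prod_ne_zero_iff.2 fun j _ => hd j)) hv h1

/-- Row `k` is the characteristic polynomial evaluated at each `x j`, weighted by `d j * x j ^ k`.
-/
theorem hankel_act_add_tail_eq_zero {a : Vec n}
    (hθ : ∀ i, (θ i : ℂ) = ∑ j, d j * x j ^ (i : ℕ))
    (ha : ∀ j, x j ^ n + ∑ i : Fin n, (a i : ℂ) * x j ^ (i : ℕ) = 0) :
    act (Hankel θ) a + tailVec θ = 0 := by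
  ext k
  apply Complex.ofReal_injective
  have h1 : (act (Hankel θ) a + tailVec θ) k =
      ∑ l : Fin n, θ ⟨(k : ℕ) + l, by omega⟩ * a l + θ ⟨n + (k : ℕ), by omega⟩ := rfl
  rw [h1]
  push_cast
  simp only [hθ]
  calc _ = ∑ j, d j * x j ^ (k : ℕ) * (x j ^ n + ∑ i : Fin n, (a i : ℂ) * x j ^ (i : ℕ)) := by
        simp only [mul_add, Finset.sum_add_distrib, Finset.mul_sum, Finset.sum_mul]
        rw [Finset.sum_comm, add_comm]
        congr 1
        · exact Finset.sum_congr rfl fun j _ => by rw [pow_add]; ring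
        · exact Finset.sum_congr rfl fun j _ => Finset.sum_congr rfl fun i _ => by
            rw [pow_add]; ring
    _ = _ := by simp [ha]

end HankelOfModes

/-! ### Modal form of the steady state and persistent excitation. -/

namespace Plant

open MeasureTheory

variable {nz nv nw ns n : ℕ} {P : Plant nz nv nw ns} {zs : Par nv nw ns → Vec nz}
  {freq : Vec ns → Fin n → ℝ} {C : Par nv nw ns → Fin n → ℂ} {m : Fin (2 * n) → ℝ}

theorem ModalExpansion.continuous_uss_flow (hexp : P.ModalExpansion zs freq C)
    {μ : Par nv nw ns} (hμ : μ ∈ P.Ω) : Continuous fun t => P.uss zs (P.flow t μ) := by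
  have h : (fun t => P.uss zs (P.flow t μ)) = fun t : ℝ =>
      (∑ j, C μ j * Complex.exp (Complex.I * (freq μ.2.2 j : ℂ) * (t : ℂ))).re := by
    ext t; rw [← hexp.2 μ hμ t, Complex.ofReal_re]
  rw [h]
  fun_prop

theorem continuous_act_exp : Continuous fun τ : ℝ =>
    act (NormedSpace.exp ((-τ) • companion m)) (Nvec n) :=
  (PiLp.continuous_toLp 2 _).comp
    ((continuous_exp_real.comp (continuous_neg.smul continuous_const)).matrix_mulVec
      continuous_const)

theorem exists_act_exp_bound (hM : IsHurwitz (companion m)) :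
    ∃ ε K : ℝ, 0 < ε ∧ 0 ≤ K ∧ ∀ τ : ℝ, τ ≤ 0 →
      ‖act (NormedSpace.exp ((-τ) • companion m)) (Nvec n)‖ ≤ K * Real.exp (ε * τ) := by
  obtain ⟨ε, K, hε, hK0, hK⟩ := exists_impulse_bound hM
  let L := (EuclideanSpace.equiv (Fin (2 * n)) ℝ).symm.toContinuousLinearMap
  refine ⟨ε, ‖L‖ * K, hε, by positivity, fun τ hτ => ?_⟩
  have h1 := L.le_opNorm (act (NormedSpace.exp ((-τ) • companion m)) (Nvec n)).ofLp
  refine h1.trans ?_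
  rw [mul_assoc]
  refine mul_le_mul_of_nonneg_left ?_ (norm_nonneg _)
  refine (pi_norm_le_iff_of_nonneg (by positivity)).2 fun i => ?_
  have := hK τ hτ i
  rwa [← ofReal_act_exp, Complex.norm_real] at this

theorem exists_uss_bound (hP : P.Standing) (hzs : P.Regulator zs) :
    ∃ B : ℝ, 0 ≤ B ∧ ∀ μ ∈ P.Ω, ‖P.uss zs μ‖ ≤ B := by
  obtain ⟨B, hB⟩ := hP.isCompact_Ω.exists_bound_of_continuousOn (hP.continuousOn_uss hzs)
  exact ⟨max B 0, le_max_right _ _, fun μ hμ => (hB μ hμ).trans (le_max_left _ _)⟩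

/-- One dominating function serves all of `Ω`, because the backward orbit stays in `Ω`, where the
input is bounded. It yields both the continuity of `etaStar` and the integrability needed to take
components. -/
theorem exists_etaStar_bound (hP : P.Standing) (hzs : P.Regulator zs) (hS : P.ImaginarySpectrum)
    (hM : IsHurwitz (companion m)) :
    ∃ g : ℝ → ℝ, IntegrableOn g (Set.Iic 0) ∧ ∀ μ ∈ P.Ω, ∀ τ : ℝ, τ ≤ 0 →
      ‖P.uss zs (P.flow τ μ) • act (NormedSpace.exp ((-τ) • companion m)) (Nvec n)‖ ≤ g τ := by
  obtain ⟨ε, K, hε, hK0, hK⟩ := exists_act_exp_bound hM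
  obtain ⟨B, hB0, hB⟩ := exists_uss_bound hP hzs
  refine ⟨fun τ => B * (K * Real.exp (ε * τ)),
    ((integrableOn_exp_mul_Iic hε 0).const_mul K).const_mul B, fun μ hμ τ hτ => ?_⟩
  rw [norm_smul]
  exact mul_le_mul (hB _ (hP.flow_mem hS hμ τ)) (hK τ hτ) (norm_nonneg _) hB0

theorem aestronglyMeasurable_etaStar (hexp : P.ModalExpansion zs freq C)
    {μ : Par nv nw ns} (hμ : μ ∈ P.Ω) (ν : Measure ℝ) : AEStronglyMeasurable
      (fun τ => P.uss zs (P.flow τ μ) • act (NormedSpace.exp ((-τ) • companion m)) (Nvec n)) ν :=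
  ((hexp.continuous_uss_flow hμ).smul continuous_act_exp).aestronglyMeasurable

theorem continuousOn_etaStar (hP : P.Standing) (hzs : P.Regulator zs) (hS : P.ImaginarySpectrum)
    (hexp : P.ModalExpansion zs freq C) (hM : IsHurwitz (companion m)) :
    ContinuousOn (P.etaStar zs m) P.Ω := by
  obtain ⟨g, hg, hbound⟩ := exists_etaStar_bound hP hzs hS hM
  refine continuousOn_of_dominated (bound := g)
    (fun μ hμ => aestronglyMeasurable_etaStar hexp hμ _) (fun μ hμ => ?_) hg
    (Filter.Eventually.of_forall fun τ => ?_)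
  · filter_upwards [ae_restrict_mem measurableSet_Iic] with τ hτ
    exact hbound μ hμ τ hτ
  · exact ((hP.continuousOn_uss hzs).comp (hP.continuous_flow τ).continuousOn
      fun μ hμ => hP.flow_mem hS hμ τ).smul continuousOn_const

theorem ofReal_etaStar (hP : P.Standing) (hzs : P.Regulator zs) (hS : P.ImaginarySpectrum)
    (hexp : P.ModalExpansion zs freq C) (hM : IsHurwitz (companion m))
    {μ : Par nv nw ns} (hμ : μ ∈ P.Ω) (i : Fin (2 * n)) :
    ((P.etaStar zs m μ i : ℝ) : ℂ) = ∑ j, C μ j * modalGain m (freq μ.2.2 j) i := by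
  obtain ⟨g, hg, hbound⟩ := exists_etaStar_bound hP hzs hS hM
  have hint : IntegrableOn (fun τ => P.uss zs (P.flow τ μ) •
      act (NormedSpace.exp ((-τ) • companion m)) (Nvec n)) (Set.Iic 0) := by
    refine Integrable.mono' hg (aestronglyMeasurable_etaStar hexp hμ _) ?_
    filter_upwards [ae_restrict_mem measurableSet_Iic] with τ hτ
    exact hbound μ hμ τ hτ
  have h1 : P.etaStar zs m μ i = ∫ τ in Set.Iic (0 : ℝ), P.uss zs (P.flow τ μ) *
      act (NormedSpace.exp ((-τ) • companion m)) (Nvec n) i :=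
    ((EuclideanSpace.proj (𝕜 := ℝ) i).integral_comp_comm hint).symm
  rw [h1, ← integral_complex_ofReal]
  have h2 : ∀ τ : ℝ, ((P.uss zs (P.flow τ μ) *
      act (NormedSpace.exp ((-τ) • companion m)) (Nvec n) i : ℝ) : ℂ) =
      ∑ j, C μ j * (Complex.exp (Complex.I * (freq μ.2.2 j : ℂ) * (τ : ℂ)) *
        impulse m (-τ) i) := by
    intro τ
    rw [Complex.ofReal_mul, ofReal_act_exp, hexp.2 μ hμ τ, Finset.sum_mul]
    exact Finset.sum_congr rfl fun j _ => mul_assoc _ _ _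
  simp only [h2]
  rw [integral_finsetSum _ fun j _ => (integrableOn_modal hM _ i).const_mul _]
  simp only [integral_const_mul]
  rfl

theorem etaStar_modes (hP : P.Standing) (hzs : P.Regulator zs) (hS : P.ImaginarySpectrum)
    (hexp : P.ModalExpansion zs freq C) (hC : ∀ μ ∈ P.Ω, ∀ j, C μ j ≠ 0)
    (hM : IsHurwitz (companion m)) (hn : 0 < n) {μ : Par nv nw ns} (hμ : μ ∈ P.Ω) :
    ∃ d : Fin n → ℂ, (∀ j, d j ≠ 0) ∧ ∀ i, ((P.etaStar zs m μ i : ℝ) : ℂ) =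
      ∑ j, d j * (Complex.I * freq μ.2.2 j) ^ (i : ℕ) := by
  refine ⟨fun j => C μ j * modalGain m (freq μ.2.2 j) ⟨0, by omega⟩,
    fun j => mul_ne_zero (hC μ hμ j) (modalGain_ne_zero hM hn _), fun i => ?_⟩
  rw [ofReal_etaStar hP hzs hS hexp hM hμ]
  refine Finset.sum_congr rfl fun j _ => ?_
  rw [modalGain_pow hM hn _ i i.2]
  ring

/-- The steady state and the true parameter satisfy `Θ(𝛈⋆) a + col(𝛈⋆_{n+1}, …, 𝛈⋆_{2n}) = 0`. -/
theorem hankel_etaStar_eq (hP : P.Standing) (hzs : P.Regulator zs) (hS : P.ImaginarySpectrum)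
    (hexp : P.ModalExpansion zs freq C) (hC : ∀ μ ∈ P.Ω, ∀ j, C μ j ≠ 0)
    {a : Vec ns → Vec n} (ha : P.GeneratorCoeff zs a)
    (hM : IsHurwitz (companion m)) (hn : 0 < n) {μ : Par nv nw ns} (hμ : μ ∈ P.Ω) :
    act (Hankel (P.etaStar zs m μ)) (a μ.2.2) + tailVec (P.etaStar zs m μ) = 0 := by
  obtain ⟨d, -, hd⟩ := etaStar_modes hP hzs hS hexp hC hM hn hμ
  exact hankel_act_add_tail_eq_zero hd fun j =>
    char_root_of_sum_exp (hexp.1 _ hμ.2.2) (hC μ hμ) (hexp.2 μ hμ) (ha μ hμ) j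

theorem continuous_act_hankel : Continuous fun p : Vec (2 * n) × Vec n => act (Hankel p.1) p.2 := by
  refine (PiLp.continuous_toLp 2 _).comp (Continuous.matrix_mulVec ?_ ?_)
  · refine continuous_matrix fun i j => ?_
    simp only [Hankel]
    fun_prop
  · exact (PiLp.continuous_ofLp 2 _).comp continuous_snd

/-- Persistent excitation: `Θ(𝛈⋆)` is uniformly nonsingular. -/
theorem exists_hankel_lower_bound (hP : P.Standing) (hzs : P.Regulator zs)
    (hS : P.ImaginarySpectrum) (hexp : P.ModalExpansion zs freq C)
    (hC : ∀ μ ∈ P.Ω, ∀ j, C μ j ≠ 0) (hM : IsHurwitz (companion m)) (hn : 0 < n) :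
    ∃ l : ℝ, 0 < l ∧ ∀ μ ∈ P.Ω, ∀ x : Vec n,
      l * ‖x‖ ≤ ‖act (Hankel (P.etaStar zs m μ)) x‖ := by
  -- The constant `l` bounds this function from below on the compact product of `Ω` with the unit
  -- sphere; homogeneity then extends the bound to all `x`.
  have hcont : ContinuousOn (fun p : Par nv nw ns × Vec n =>
      ‖act (Hankel (P.etaStar zs m p.1)) p.2‖) (P.Ω ×ˢ Metric.sphere 0 1) := by
    refine (continuous_act_hankel.comp_continuousOn (ContinuousOn.prodMk ?_ ?_)).norm
    · exact (continuousOn_etaStar hP hzs hS hexp hM).comp continuousOn_fst fun p hp => hp.1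
    · exact continuousOn_snd
  obtain ⟨l, hl, hmin⟩ := (hP.isCompact_Ω.prod (isCompact_sphere _ _)).exists_forall_le'
    hcont (a := 0) (fun p hp => by
      refine norm_pos_iff.2 fun h0 => ?_
      obtain ⟨d, hd0, hd⟩ := etaStar_modes hP hzs hS hexp hC hM hn hp.1
      have hdet := hankel_det_ne_zero (injective_I_mul (hexp.1 _ hp.1.2.2)) hd0 hd
      have h1 : Hankel (P.etaStar zs m p.1) *ᵥ p.2.ofLp = 0 := congrArg WithLp.ofLp h0
      have h2 : p.2 = 0 := by
        ext i
        exact congrFun (Matrix.eq_zero_of_mulVec_eq_zero hdet h1) i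
      have h3 : ‖p.2‖ = 1 := by simpa using hp.2
      simp [h2] at h3)
  refine ⟨l, hl, fun μ hμ x => ?_⟩
  rcases eq_or_ne x 0 with rfl | hx
  · simp
  have hxn : 0 < ‖x‖ := norm_pos_iff.2 hx
  have h := hmin (μ, ‖x‖⁻¹ • x) ⟨hμ, by simp [norm_smul, hxn.ne']⟩
  have hact : act (Hankel (P.etaStar zs m μ)) (‖x‖⁻¹ • x) =
      ‖x‖⁻¹ • act (Hankel (P.etaStar zs m μ)) x := by
    simp [act, Matrix.mulVec_smul]
  simp only [hact, norm_smul, norm_inv, norm_norm] at h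
  rwa [inv_mul_eq_div, le_div_iff₀ hxn] at h

end Plant
/-! ### Algebra of the learning law -/

section Algebra

variable {k l n : ℕ}

theorem act_add (A : Matrix (Fin k) (Fin l) ℝ) (x y : Vec l) :
    act A (x + y) = act A x + act A y := by
  simp [act, Matrix.mulVec_add]

theorem act_neg (A : Matrix (Fin k) (Fin l) ℝ) (x : Vec l) : act A (-x) = -act A x := by
  simp [act, Matrix.mulVec_neg]

theorem add_act (A B : Matrix (Fin k) (Fin l) ℝ) (x : Vec l) :
    act (A + B) x = act A x + act B x := by
  simp [act, Matrix.add_mulVec]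

theorem inner_act_transpose (A : Matrix (Fin k) (Fin l) ℝ) (x : Vec l) (y : Vec k) :
    inner ℝ x (act Aᵀ y) = inner ℝ (act A x) y := by
  simp only [EuclideanSpace.inner_eq_star_dotProduct, act, star_trivial]
  rw [Matrix.dotProduct_mulVec, Matrix.mulVec_transpose]

theorem hankel_add (x y : Vec (2 * n)) : Hankel (x + y) = Hankel x + Hankel y := rfl

theorem tailVec_add (x y : Vec (2 * n)) : tailVec (x + y) = tailVec x + tailVec y := rfl

theorem norm_le_card_mul {x : Vec k} {b : ℝ} (hb : 0 ≤ b) (h : ∀ i, |x i| ≤ b) :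
    ‖x‖ ≤ k * b := by
  refine le_of_sq_le_sq ?_ (by positivity)
  rw [EuclideanSpace.real_norm_sq_eq]
  calc ∑ i, x i ^ 2 ≤ ∑ _i : Fin k, b ^ 2 :=
        Finset.sum_le_sum fun i _ => sq_le_sq' (abs_le.1 (h i)).1 (abs_le.1 (h i)).2
    _ = k * b ^ 2 := by simp
    _ ≤ (k * b) ^ 2 := by
      rw [mul_pow]
      refine mul_le_mul_of_nonneg_right ?_ (sq_nonneg b)
      exact_mod_cast Nat.le_self_pow two_ne_zero k

theorem abs_apply_le (x : Vec k) (i : Fin k) : |x i| ≤ ‖x‖ := PiLp.norm_apply_le x i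

theorem norm_tailVec_le (θ : Vec (2 * n)) : ‖tailVec θ‖ ≤ n * ‖θ‖ :=
  norm_le_card_mul (norm_nonneg _) fun _ => abs_apply_le θ _

theorem norm_act_hankel_le (θ : Vec (2 * n)) (x : Vec n) :
    ‖act (Hankel θ) x‖ ≤ n * n * ‖θ‖ * ‖x‖ := by
  have : ‖act (Hankel θ) x‖ ≤ n * (n * (‖θ‖ * ‖x‖)) := by
    refine norm_le_card_mul (by positivity) fun i => ?_
    calc |∑ j, Hankel θ i j * x j| ≤ ∑ j, |Hankel θ i j * x j| := Finset.abs_sum_le_sum_abs _ _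
      _ ≤ ∑ _j : Fin n, ‖θ‖ * ‖x‖ := Finset.sum_le_sum fun j _ => by
        rw [abs_mul]
        exact mul_le_mul (abs_apply_le θ _) (abs_apply_le x j) (abs_nonneg _) (norm_nonneg _)
      _ = n * (‖θ‖ * ‖x‖) := by simp
  linarith

/-- In error coordinates, the learning law is the parameter error equation. -/
theorem abarField_eq_learnField {ηs : Vec (2 * n)} {a : Vec n}
    (h : act (Hankel ηs) a + tailVec ηs = 0) (k1 : ℝ) (ηe : Vec (2 * n)) (ab : Vec n) :
    abarField k1 ηs a ηe ab = learnField k1 (ηs + ηe) (ab + a) := by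
  have ht : tailVec ηs = -act (Hankel ηs) a := eq_neg_of_add_eq_zero_right h
  simp only [abarField, Obar, learnField, hankel_add, tailVec_add, Matrix.transpose_add, act_add,
    add_act, ht, act_neg]
  module

end Algebra

/-! ### The Lyapunov function -/

section Lyapunov

variable {n : ℕ}

theorem contDiff_Vabar : ContDiff ℝ ∞ (Vabar : Vec n → ℝ) :=
  (contDiff_const.add (contDiff_norm_sq ℝ)).log fun x => by positivity

theorem differentiable_Vabar : Differentiable ℝ (Vabar : Vec n → ℝ) :=
  contDiff_Vabar.differentiable (by simp)

theorem fderiv_Vabar (x v : Vec n) :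
    fderiv ℝ Vabar x v = 2 * inner ℝ x v / (1 + ‖x‖ ^ 2) := by
  have h := ((hasStrictFDerivAt_norm_sq x).hasFDerivAt.const_add 1).log
    (by positivity : 1 + ‖x‖ ^ 2 ≠ 0)
  have h2 : fderiv ℝ Vabar x = _ := h.fderiv
  rw [h2]
  simp
  ring

/-- The link between the class `𝒦_o` rate `1 - exp(-s)` and the quotient that appears in both the
dissipation and the mismatch estimates. -/
theorem one_sub_exp_neg_Vabar (x : Vec n) :
    1 - Real.exp (-Vabar x) = ‖x‖ ^ 2 / (1 + ‖x‖ ^ 2) := by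
  have : 0 < 1 + ‖x‖ ^ 2 := by positivity
  rw [Vabar, Real.exp_neg, Real.exp_log this]
  field_simp
  ring

theorem isClassKo_one_sub_exp {κ : ℝ} (hκ : 0 < κ) :
    IsClassKo fun s => κ * (1 - Real.exp (-s)) := by
  refine ⟨⟨by fun_prop, by simp, fun s _ t _ hst => ?_⟩, κ, ?_⟩
  · have := Real.exp_lt_exp.2 (neg_lt_neg hst)
    exact mul_lt_mul_of_pos_left (by linarith) hκ
  · rintro _ ⟨s, -, rfl⟩
    have := Real.exp_pos (-s)
    show κ * (1 - Real.exp (-s)) ≤ κ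
    nlinarith

theorem isClassKInf_log_one_add : IsClassKInf fun s => Real.log (1 + s) := by
  refine ⟨⟨?_, by simp, fun s hs t _ hst => ?_⟩, ?_⟩
  · refine ContinuousOn.log (by fun_prop) fun s hs => ?_
    have : (0 : ℝ) ≤ s := hs
    positivity
  · have : (0 : ℝ) ≤ s := hs
    exact Real.log_lt_log (by linarith) (by linarith)
  · rintro ⟨B, hB⟩
    have h := hB ⟨Real.exp (|B| + 1) - 1, by simp; positivity, rfl⟩
    simp at h
    linarith [le_abs_self B]

/-- Dissipation of `Vabar` along the learning law. -/
theorem fderiv_Vabar_learnField_le {k1 l A : ℝ} (hk1 : 0 < k1) (hl : 0 < l)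
    {ηs : Vec (2 * n)} {a : Vec n} (h : act (Hankel ηs) a + tailVec ηs = 0)
    (hlow : ∀ x : Vec n, l * ‖x‖ ≤ ‖act (Hankel ηs) x‖) (hA : ‖a‖ ≤ A)
    (ηe : Vec (2 * n)) (ab : Vec n) :
    fderiv ℝ Vabar ab (learnField k1 (ηs + ηe) (ab + a)) ≤
      -(k1 * l ^ 2 / 2 * (1 - Real.exp (-Vabar ab))) +
        k1 * ((n * n : ℝ) ^ 2 + (n * n * A + n) ^ 2) * ‖ηe‖ ^ 2 := by
  -- The regression identity at the steady state removes the part of the residual that does not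
  -- vanish with the errors, leaving `p + q`.
  set p := act (Hankel (ηs + ηe)) ab with hp
  set q := act (Hankel ηe) a + tailVec ηe with hq
  have hA0 : 0 ≤ A := (norm_nonneg a).trans hA
  have hres : act (Hankel (ηs + ηe)) (ab + a) + tailVec (ηs + ηe) = p + q := by
    rw [act_add, tailVec_add, hankel_add, add_act _ _ a, ← hankel_add, hq]
    calc _ = p + (act (Hankel ηe) a + tailVec ηe) + (act (Hankel ηs) a + tailVec ηs) := by
          rw [hp]; abel
      _ = _ := by rw [h, add_zero]
  have hinner : inner ℝ ab (learnField k1 (ηs + ηe) (ab + a)) = -(k1 * inner ℝ p (p + q)) := by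
    rw [learnField, hres, inner_neg_right, inner_smul_right, inner_act_transpose]
  have hpq : -inner ℝ p (p + q) ≤ -(‖p‖ ^ 2) / 2 + ‖q‖ ^ 2 / 2 := by
    rw [inner_add_right, real_inner_self_eq_norm_sq]
    have h1 := neg_le_of_abs_le (abs_real_inner_le_norm p q)
    nlinarith [sq_nonneg (‖p‖ - ‖q‖)]
  have hqn : ‖q‖ ≤ (n * n * A + n) * ‖ηe‖ := by
    calc ‖q‖ ≤ n * n * ‖ηe‖ * ‖a‖ + n * ‖ηe‖ :=
          (norm_add_le _ _).trans (add_le_add (norm_act_hankel_le _ _) (norm_tailVec_le _))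
      _ ≤ n * n * ‖ηe‖ * A + n * ‖ηe‖ := by gcongr
      _ = _ := by ring
  have hq2 : ‖q‖ ^ 2 ≤ (n * n * A + n) ^ 2 * ‖ηe‖ ^ 2 := by
    rw [← mul_pow]; gcongr
  -- Excitation is known only at the steady state, so `Θ(η)` is compared with `Θ(𝛈⋆)` at the cost of
  -- a term bilinear in `ηe` and `ab`.
  have hpn : l * ‖ab‖ ≤ ‖p‖ + n * n * ‖ηe‖ * ‖ab‖ := by
    have h1 : act (Hankel ηs) ab = p - act (Hankel ηe) ab := by
      rw [hp, hankel_add, add_act]; abel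
    have h2 := hlow ab
    rw [h1] at h2
    exact (h2.trans (norm_sub_le _ _)).trans (by gcongr; exact norm_act_hankel_le _ _)
  have hp2 : (l * ‖ab‖) ^ 2 ≤ 2 * ‖p‖ ^ 2 + 2 * (n * n * ‖ηe‖ * ‖ab‖) ^ 2 := by
    have h1 : (l * ‖ab‖) ^ 2 ≤ (‖p‖ + n * n * ‖ηe‖ * ‖ab‖) ^ 2 := by gcongr
    nlinarith [sq_nonneg (‖p‖ - n * n * ‖ηe‖ * ‖ab‖)]
  rw [fderiv_Vabar, one_sub_exp_neg_Vabar, hinner]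
  have hr : 0 < 1 + ‖ab‖ ^ 2 := by positivity
  rw [div_le_iff₀ hr, add_mul, neg_mul, mul_div_assoc', div_mul_cancel₀ _ hr.ne']
  -- After multiplying by `1 + ‖ab‖²`, this factor on the right absorbs the term `‖ηe‖² ‖ab‖²`
  -- coming from `hp2`.
  have hfin : -inner ℝ p (p + q) * 2 ≤ -(l ^ 2 / 2 * ‖ab‖ ^ 2) +
      ((n * n : ℝ) ^ 2 + (n * n * A + n) ^ 2) * ‖ηe‖ ^ 2 * (1 + ‖ab‖ ^ 2) := by
    have e1 : 0 ≤ (n * n : ℝ) ^ 2 * ‖ηe‖ ^ 2 := by positivity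
    have e2 : 0 ≤ (n * n * A + n : ℝ) ^ 2 * ‖ηe‖ ^ 2 * ‖ab‖ ^ 2 := by positivity
    nlinarith
  have := mul_le_mul_of_nonneg_left hfin hk1.le
  linarith

end Lyapunov

/-! ### The saturated mismatch -/

section Mismatch

variable {n : ℕ} (m : Fin (2 * n) → ℝ) (D : Set (Vec (2 * n) × Vec n))

theorem contDiff_companion_pow (p : ℕ) : ∀ i j : Fin n,
    ContDiff ℝ ∞ fun a : Vec n => (companion a.ofLp ^ p) i j := by
  induction p with
  | zero => intro i j; simpa using contDiff_const
  | succ p ih =>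
    intro i j
    simp only [pow_succ, Matrix.mul_apply]
    refine ContDiff.sum fun r _ => (ih i r).mul ?_
    unfold companion
    split_ifs
    · fun_prop
    · exact contDiff_const
    · exact contDiff_const

theorem contDiff_chi : ContDiff ℝ ∞ fun p : Vec (2 * n) × Vec n => chi m p.1 p.2 := by
  simp only [chi, dotProduct, Matrix.mulVec, Xi, Matrix.add_apply, Matrix.sum_apply,
    Matrix.smul_apply, headVec]
  refine ContDiff.sum fun i _ => contDiff_const.mul (ContDiff.sum fun j _ => ContDiff.mul ?_ ?_)
  · refine ContDiff.add ((contDiff_companion_pow _ i j).comp contDiff_snd)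
      (ContDiff.sum fun r _ => ?_)
    exact ((contDiff_companion_pow _ i j).comp contDiff_snd).const_smul _
  · fun_prop

theorem contDiff_chiS : ContDiff ℝ ∞ fun p : Vec (2 * n) × Vec n => chiS m D p.1 p.2 := by
  refine (contDiff_chi m).mul (Real.smoothTransition.contDiff.comp (contDiff_const.sub ?_))
  exact (contDiff_fst.norm_sq ℝ).add (contDiff_snd.norm_sq ℝ)

theorem hasCompactSupport_chiS :
    HasCompactSupport fun p : Vec (2 * n) × Vec n => chiS m D p.1 p.2 := by
  refine HasCompactSupport.intro (isCompact_closedBall (0 : Vec (2 * n) × Vec n)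
    (|deltaD D| + 1)) fun p hp => ?_
  have hp' : |deltaD D| + 1 < ‖p‖ := by simpa using hp
  -- A radius `R ≥ 1` satisfies `R ≤ R²`, so one component in the sup norm already pushes the cutoff
  -- argument below zero.
  have h1 : |deltaD D| + 1 ≤ ‖p.1‖ ^ 2 + ‖p.2‖ ^ 2 := by
    have h0 := abs_nonneg (deltaD D)
    rcases lt_max_iff.1 (by rwa [Prod.norm_def] at hp') with h | h
    · nlinarith [sq_nonneg ‖p.2‖]
    · nlinarith [sq_nonneg ‖p.1‖]
  have h2 := le_abs_self (deltaD D)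
  simp only [chiS]
  rw [Real.smoothTransition.zero_of_nonpos (by linarith), mul_zero]

/-- The cutoff is `1` on `D`, so the mismatch becomes a difference of two values of the same
Lipschitz function. -/
theorem chiS_eq_chi {m D} (hD : IsCompact D) {p : Vec (2 * n) × Vec n} (hp : p ∈ D) :
    chiS m D p.1 p.2 = chi m p.1 p.2 := by
  have hle : ‖p.1‖ ^ 2 + ‖p.2‖ ^ 2 ≤ deltaD D :=
    le_csSup (hD.image (by fun_prop)).bddAbove ⟨p, hp, rfl⟩
  rw [chiS, Real.smoothTransition.one_of_one_le (by linarith), mul_one]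

theorem exists_chiS_sub_sq_le :
    ∃ B : ℝ, 0 ≤ B ∧ ∀ (η ηe : Vec (2 * n)) (a ab : Vec n),
      |chiS m D (η + ηe) (ab + a) - chiS m D η a| ^ 2 ≤
        B * ‖ηe‖ ^ 2 + B * (1 - Real.exp (-Vabar ab)) := by
  obtain ⟨L, hL⟩ := ContDiff.lipschitzWith_of_hasCompactSupport (hasCompactSupport_chiS m D)
    (contDiff_chiS m D) (by simp)
  obtain ⟨K, hK⟩ := (hasCompactSupport_chiS m D).exists_bound_of_continuous
    (contDiff_chiS m D).continuous
  have hK0 : 0 ≤ K := (norm_nonneg _).trans (hK 0)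
  -- For `‖ab‖ ≤ 1` the Lipschitz bound gives `2 L²`; for `‖ab‖ ≥ 1` the bound `X ≤ 2 K` gives `8
  -- K²`. Both use that `min(‖ab‖², 1)` is at most twice `‖ab‖² / (1 + ‖ab‖²)`.
  refine ⟨2 * L ^ 2 + 8 * K ^ 2, by positivity, fun η ηe a ab => ?_⟩
  rw [one_sub_exp_neg_Vabar]
  set X := |chiS m D (η + ηe) (ab + a) - chiS m D η a| with hX
  have hX0 : 0 ≤ X := abs_nonneg _
  have h1 : X ≤ 2 * K := by
    have := norm_sub_le_of_le (hK (η + ηe, ab + a)) (hK (η, a))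
    rw [two_mul]; exact this
  have h2 : X ≤ L * max ‖ηe‖ ‖ab‖ := by
    have := hL.norm_sub_le (η + ηe, ab + a) (η, a)
    simpa [Prod.norm_def] using this
  have h3 : X ^ 2 ≤ L ^ 2 * (‖ηe‖ ^ 2 + ‖ab‖ ^ 2) := by
    calc X ^ 2 ≤ (L * max ‖ηe‖ ‖ab‖) ^ 2 := by gcongr
      _ = L ^ 2 * max ‖ηe‖ ‖ab‖ ^ 2 := mul_pow _ _ _
      _ ≤ _ := by
        gcongr
        rcases max_choice ‖ηe‖ ‖ab‖ with h | h <;> rw [h] <;> nlinarith [sq_nonneg ‖ηe‖,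
          sq_nonneg ‖ab‖]
  have hpos : 0 < 1 + ‖ab‖ ^ 2 := by positivity
  have hL2 : (0 : ℝ) ≤ (L : ℝ) ^ 2 := by positivity
  have hE : 0 ≤ (L : ℝ) ^ 2 * ‖ηe‖ ^ 2 + 8 * K ^ 2 * ‖ηe‖ ^ 2 := by positivity
  rcases le_total (‖ab‖ ^ 2) 1 with h | h
  · have h5 : ‖ab‖ ^ 2 ≤ 2 * (‖ab‖ ^ 2 / (1 + ‖ab‖ ^ 2)) := by
      rw [mul_div_assoc', le_div_iff₀ hpos]
      nlinarith [sq_nonneg ‖ab‖]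
    have h6 : 0 ≤ ‖ab‖ ^ 2 / (1 + ‖ab‖ ^ 2) := by positivity
    nlinarith [mul_le_mul_of_nonneg_left h5 hL2, mul_nonneg (sq_nonneg K) h6]
  · have h5 : 1 ≤ 2 * (‖ab‖ ^ 2 / (1 + ‖ab‖ ^ 2)) := by
      rw [mul_div_assoc', le_div_iff₀ hpos]
      linarith
    have h7 : X ^ 2 ≤ 4 * K ^ 2 := by nlinarith
    have h8 := mul_le_mul_of_nonneg_left h5 (by positivity : 0 ≤ 4 * K ^ 2 + (L : ℝ) ^ 2)
    nlinarith

end Mismatch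

/-! ### The change of coordinates for the internal model error. -/

namespace Plant

variable {nz nv nw ns n : ℕ} {P : Plant nz nv nw ns} {zs : Par nv nw ns → Vec nz}

theorem exists_norm_etaE_sq_le (hP : P.Standing) (zs : Par nv nw ns → Vec nz) (n : ℕ) :
    ∃ E : ℝ, 0 < E ∧ ∀ μ ∈ P.Ω, ∀ (zb : Vec nz) (ηb : Vec (2 * n)) (e : ℝ),
      ‖P.etaE zs zb ηb e μ‖ ^ 2 ≤ E * (‖ηb‖ ^ 2 + ‖zb‖ ^ 2) + E * e ^ 2 := by
  obtain ⟨bl, hbl, hb⟩ := hP.b_lower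
  refine ⟨2 + 2 * (bl⁻¹ * ‖Nvec n‖) ^ 2, by positivity, fun μ hμ zb ηb e => ?_⟩
  have hinv : |(P.bBar zs zb e μ)⁻¹| ≤ bl⁻¹ := by
    have h : bl ≤ P.bBar zs zb e μ := hb μ hμ _ _
    rw [abs_inv, abs_of_pos (hbl.trans_le h)]
    exact inv_anti₀ hbl h
  have h1 : ‖P.etaE zs zb ηb e μ‖ ≤ ‖ηb‖ + bl⁻¹ * ‖Nvec n‖ * |e| := by
    refine (norm_add_le _ _).trans (add_le_add_right ?_ _)
    rw [norm_smul, Real.norm_eq_abs, abs_mul]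
    calc _ ≤ bl⁻¹ * |e| * ‖Nvec n‖ := by gcongr
      _ = _ := by ring
  have h2 : ‖P.etaE zs zb ηb e μ‖ ^ 2 ≤ (‖ηb‖ + bl⁻¹ * ‖Nvec n‖ * |e|) ^ 2 := by gcongr
  have h3 := sq_abs e
  set G := bl⁻¹ * ‖Nvec n‖
  have e1 : (G * |e|) ^ 2 = G ^ 2 * e ^ 2 := by rw [mul_pow, h3]
  have e2 : 0 ≤ G ^ 2 * ‖ηb‖ ^ 2 := by positivity
  have e3 : 0 ≤ (2 + 2 * G ^ 2) * ‖zb‖ ^ 2 := by positivity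
  nlinarith [sq_nonneg (‖ηb‖ - G * |e|), sq_nonneg e]

/-- Along solutions this turns the actual learning law into the one for which the pointwise
dissipation is proved. -/
theorem etaStar_add_etaE (m : Fin (2 * n) → ℝ) (z : Vec nz) (y : ℝ) (η : Vec (2 * n))
    (μ : Par nv nw ns) :
    P.etaStar zs m μ + P.etaE zs (z - zs μ) (P.errEta zs m z y η μ) (P.errE y μ) μ = η := by
  simp only [etaE, errEta]
  abel

end Plant

end OutputReg

end

/-! ### Assembly of the estimates. -/

theorem mainTheorem10 {nz nv nw ns n : ℕ} (hn : 0 < n)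
    (P : Plant nz nv nw ns) (hP : P.Standing)
    (zs : Par nv nw ns → Vec nz) (hzs : P.Regulator zs)
    (hS : P.ImaginarySpectrum) (hpoly : P.PolynomialInput zs)
    (freq : Vec ns → Fin n → ℝ) (C : Par nv nw ns → Fin n → ℂ)
    (hexp : P.ModalExpansion zs freq C) (hC : ∀ μ ∈ P.Ω, ∀ j, C μ j ≠ 0)
    (a : Vec ns → Vec n) (ha : P.GeneratorCoeff zs a)
    (m : Fin (2 * n) → ℝ) (hM : IsHurwitz (companion m))
    (D : Set (Vec (2 * n) × Vec n)) (hD : IsCompact D)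
    (hDmem : ∀ μ ∈ P.Ω, (P.etaStar zs m μ, a μ.2.2) ∈ D)
    (k1 : ℝ) (hk1 : 0 < k1) :
    ContDiff ℝ ∞ (Vabar : Vec n → ℝ) ∧
    ∃ αlo αup α : ℝ → ℝ, ∃ c φ0 φ1 φ2 : ℝ,
      IsClassKInf αlo ∧ IsClassKInf αup ∧ IsClassKo α ∧
      0 < c ∧ 0 < φ0 ∧ 0 < φ1 ∧ 0 < φ2 ∧
      -- bounds on the Lyapunov function
      (∀ ab : Vec n, αlo (‖ab‖ ^ 2) ≤ Vabar ab ∧ Vabar ab ≤ αup (‖ab‖ ^ 2)) ∧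
      -- its derivative along the parameter error equation, at every state of the error system
      (∀ μ ∈ P.Ω, ∀ (zb : Vec nz) (ηb : Vec (2 * n)) (e : ℝ) (ab : Vec n),
        fderiv ℝ Vabar ab
            (abarField k1 (P.etaStar zs m μ) (a μ.2.2) (P.etaE zs zb ηb e μ) ab) ≤
          -α (Vabar ab) + c * (‖ηb‖ ^ 2 + ‖zb‖ ^ 2) + c * e ^ 2) ∧
      -- its derivative along solutions of the plant with internal model and learning law
      (∀ μ₀ ∈ P.Ω, ∀ (T : ℝ) (u : ℝ → ℝ) (z : ℝ → Vec nz) (y : ℝ → ℝ) (η : ℝ → Vec (2 * n))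
        (ah : ℝ → Vec n), P.ClosedLoop m k1 T μ₀ u z y η ah →
        ∀ t ∈ Set.Ico 0 T, ∃ d : ℝ,
          HasDerivWithinAt (fun s => Vabar (ah s - a μ₀.2.2)) d (Set.Ico 0 T) t ∧
          d ≤ -α (Vabar (ah t - a μ₀.2.2))
            + c * (‖P.errEta zs m (z t) (y t) (η t) (P.flow t μ₀)‖ ^ 2
                + ‖z t - zs (P.flow t μ₀)‖ ^ 2)
            + c * (P.errE (y t) (P.flow t μ₀)) ^ 2) ∧
      -- the bound on the mismatch
      (∀ μ ∈ P.Ω, ∀ (zb : Vec nz) (ηb : Vec (2 * n)) (e : ℝ) (ab : Vec n),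
        |P.bBar zs zb e μ| ^ 2 * |P.chiBarS zs m a D (P.etaE zs zb ηb e μ) ab μ| ^ 2 ≤
          φ0 * e ^ 2 + φ1 * (‖ηb‖ ^ 2 + ‖zb‖ ^ 2) + φ2 * α (Vabar ab)) := by
  obtain ⟨l, hl, hlow⟩ := Plant.exists_hankel_lower_bound hP hzs hS hexp hC hM hn
  obtain ⟨E, hE, hηe⟩ := Plant.exists_norm_etaE_sq_le hP zs n
  obtain ⟨B, hB, hchi⟩ := exists_chiS_sub_sq_le m D
  obtain ⟨bu, hbu, hb⟩ := hP.b_upper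
  obtain ⟨bl, hbl, hb'⟩ := hP.b_lower
  obtain ⟨A, hA⟩ := hD.isBounded.exists_norm_le
  have ha_le : ∀ μ ∈ P.Ω, ‖a μ.2.2‖ ≤ A := fun μ hμ =>
    (norm_snd_le (P.etaStar zs m μ, a μ.2.2)).trans (hA _ (hDmem μ hμ))
  have hss := fun μ hμ => Plant.hankel_etaStar_eq hP hzs hS hexp hC ha hM hn (μ := μ) hμ
  set κ := k1 * l ^ 2 / 2 with hκ_def
  have hκ : 0 < κ := by positivity
  set Q := k1 * ((n * n : ℝ) ^ 2 + (n * n * A + n) ^ 2) with hQ_def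
  -- Positivity of `n` enters because `Q` is zero when `n = 0`.
  have hQ : 0 < Q := by
    have : (0 : ℝ) < n := by exact_mod_cast hn
    positivity
  -- Stated for the learning law so that it covers both the error equation and actual solutions.
  have hdiss : ∀ μ ∈ P.Ω, ∀ (zb : Vec nz) (ηb : Vec (2 * n)) (e : ℝ) (ab : Vec n),
      fderiv ℝ Vabar ab
        (learnField k1 (P.etaStar zs m μ + P.etaE zs zb ηb e μ) (ab + a μ.2.2)) ≤
        -(κ * (1 - Real.exp (-Vabar ab))) + Q * E * (‖ηb‖ ^ 2 + ‖zb‖ ^ 2) + Q * E * e ^ 2 := by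
    intro μ hμ zb ηb e ab
    have h1 := fderiv_Vabar_learnField_le hk1 hl (hss μ hμ) (hlow μ hμ) (ha_le μ hμ)
      (P.etaE zs zb ηb e μ) ab
    rw [← hκ_def, ← hQ_def] at h1
    have h2 := mul_le_mul_of_nonneg_left (hηe μ hμ zb ηb e) hQ.le
    linarith
  -- `B + 1` replaces `B`, which may be zero, to keep the constants positive; dividing by `κ` undoes
  -- the factor `κ` in the rate.
  refine ⟨contDiff_Vabar, fun s => Real.log (1 + s), fun s => Real.log (1 + s),
    fun s => κ * (1 - Real.exp (-s)), Q * E, bu ^ 2 * (B + 1) * E, bu ^ 2 * (B + 1) * E,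
    bu ^ 2 * (B + 1) / κ, isClassKInf_log_one_add, isClassKInf_log_one_add,
    isClassKo_one_sub_exp hκ, by positivity, by positivity, by positivity, by positivity,
    fun ab => ⟨le_rfl, le_rfl⟩, ?_, ?_, ?_⟩
  · intro μ hμ zb ηb e ab
    rw [abarField_eq_learnField (hss μ hμ)]
    exact hdiss μ hμ zb ηb e ab
  · intro μ₀ hμ₀ T u z y η ah hsol t ht
    -- The pointwise bound applies at the current uncertainty, which stays in `Ω`; `σ` is constant,
    -- so `a` is too, and `u` does not enter the derivative of `ah`.
    have h := hdiss (P.flow t μ₀) (hP.flow_mem hS hμ₀ t) (z t - zs (P.flow t μ₀))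
      (P.errEta zs m (z t) (y t) (η t) (P.flow t μ₀)) (P.errE (y t) (P.flow t μ₀))
      (ah t - a μ₀.2.2)
    rw [Plant.etaStar_add_etaE, show a (P.flow t μ₀).2.2 = a μ₀.2.2 from rfl,
      sub_add_cancel] at h
    exact ⟨_, (differentiable_Vabar _).hasFDerivAt.comp_hasDerivWithinAt t
      ((hsol.ah_eq t ht).sub_const _), h⟩
  · intro μ hμ zb ηb e ab
    have h1 : |P.bBar zs zb e μ| ^ 2 ≤ bu ^ 2 := by
      have hpos : 0 < P.bBar zs zb e μ := hbl.trans_le (hb' μ hμ _ _)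
      rw [abs_of_pos hpos]
      exact pow_le_pow_left₀ hpos.le (hb μ hμ _ _) 2
    have h2 : |P.chiBarS zs m a D (P.etaE zs zb ηb e μ) ab μ| ^ 2 ≤
        B * ‖P.etaE zs zb ηb e μ‖ ^ 2 + B * (1 - Real.exp (-Vabar ab)) := by
      have := hchi (P.etaStar zs m μ) (P.etaE zs zb ηb e μ) (a μ.2.2) ab
      rwa [chiS_eq_chi hD (hDmem μ hμ)] at this
    have h3 := hηe μ hμ zb ηb e
    have h4 : 0 ≤ 1 - Real.exp (-Vabar ab) := by
      rw [one_sub_exp_neg_Vabar]; positivity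
    have h5 : |P.chiBarS zs m a D (P.etaE zs zb ηb e μ) ab μ| ^ 2 ≤
        (B + 1) * (E * (‖ηb‖ ^ 2 + ‖zb‖ ^ 2) + E * e ^ 2) +
          (B + 1) * (1 - Real.exp (-Vabar ab)) := by
      have h6 := mul_le_mul_of_nonneg_left h3 (by positivity : 0 ≤ B + 1)
      linarith [sq_nonneg ‖P.etaE zs zb ηb e μ‖]
    calc _ ≤ bu ^ 2 * ((B + 1) * (E * (‖ηb‖ ^ 2 + ‖zb‖ ^ 2) + E * e ^ 2) +
          (B + 1) * (1 - Real.exp (-Vabar ab))) :=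
          mul_le_mul h1 h5 (sq_nonneg _) (sq_nonneg _)
      _ = _ := by
        field_simp
        ring
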